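/- Let $a<b$, let $\varrho\colon[a,b]\to\mathbb{R}_{>0}$ be smooth, and let $\gamma\in C^\infty([a,b];\mathbb{R}^3)$ satisfy $|\gamma'|=1$, with unit tangent $T=\gamma'$. Suppose that $\gamma$ is a holonomy constrained elastic curve with bending stiffness $\varrho$, i.e. that $$\frac{d}{dt}\Big|_{t=0}\mathcal B_\varrho(\gamma_t)=0,\qquad \mathcal B_\varrho(\gamma)=\tfrac12\int_a^b\varrho\,\big\langle\tfrac{dT}{ds},\tfrac{dT}{ds}\big\rangle\,ds ,$$ for every $\varepsilon>0$ and every smooth variation $\gamma_t$ ($t\in[-\varepsilon,\varepsilon]$, $\gamma_0=\gamma$) with compact support in the interior of $[a,b]$ (there is $\delta>0$ such that $\gamma_t=\gamma$ on $[a,a+\delta]\cup[b-\delta,b]$ for all $t$) such that each $\gamma_t$ has the same arc-length element $|\gamma_t'|=|\gamma'|$ and the same holonomy as $\gamma$. Here the holonomy of a curve with respect to unit vectors $W_a\perp T(a)$, $W_b\perp T(b)$ is the angle $\theta\in\mathbb{R}/2\pi\mathbb{Z}$ with $Z(b)=\cos\theta\,W_b+\sin\theta\,T(b)\times W_b$,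 where $Z$ is the normal field along the curve with $Z(a)=W_a$ and $Z'$ a smooth multiple of $T$. Then there are constants $\mu\in\mathbb{R}$ and $\mathbf a,\mathbf b\in\mathbb{R}^3$ such that on $[a,b]$ $$\varrho\,\gamma'\times\gamma''=-\mu\,\gamma'+\gamma\times\mathbf a+\mathbf b ,$$ and, with these constants, $$\varrho\,\langle\gamma'\times\gamma'',\,-\mu\,\gamma'+\gamma\times\mathbf a+\mathbf b\rangle\ \ge\ 0$$ on all of $[a,b]$, with strict inequality exactly at the points where $\gamma''\neq0$. -/

import Mathlib

open Set
open scoped ContDiff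

noncomputable section

/-- Euclidean three-space. -/
abbrev E3 : Type := EuclideanSpace ℝ (Fin 3)

/-- The cross product of Euclidean three-space. -/
def cross (u v : E3) : E3 :=
  WithLp.toLp 2 (crossProduct (WithLp.ofLp u) (WithLp.ofLp v))

/-- The derivative `g'` of a map defined on `[a, b]` (one-sided at the end points). -/
def der {F : Type*} [NormedAddCommGroup F] [NormedSpace ℝ F] (a b : ℝ) (g : ℝ → F) : ℝ → F :=
  fun x => derivWithin g (Icc a b) x

/-- `g ∈ C^∞([a, b]; F)`; values of `g` outside `[a, b]` play no role. -/
def SmoothOn {F : Type*} [NormedAddCommGroup F] [NormedSpace ℝ F] (a b : ℝ) (g : ℝ → F) : Prop :=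
  ContDiffOn ℝ ∞ g (Icc a b)

/-- A curve: a smooth map `γ : [a, b] → ℝ³` with `γ' ≠ 0`. -/
structure IsCurve (a b : ℝ) (γ : ℝ → E3) : Prop where
  smooth : SmoothOn a b γ
  regular : ∀ x ∈ Icc a b, der a b γ x ≠ 0

/-- Arc-length parametrization: `|γ'| = 1`. -/
def IsArcLength (a b : ℝ) (γ : ℝ → E3) : Prop :=
  ∀ x ∈ Icc a b, ‖der a b γ x‖ = 1

/-- A bending stiffness: a smooth positive function on `[a, b]`. -/
structure IsStiffness (a b : ℝ) (ϱ : ℝ → ℝ) : Prop where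
  smooth : SmoothOn a b ϱ
  pos : ∀ x ∈ Icc a b, 0 < ϱ x

/-- The derivative `dg/ds = g' / |γ'|` with respect to the arc-length of `γ`. -/
def arcDer (a b : ℝ) (γ g : ℝ → E3) : ℝ → E3 :=
  fun x => ‖der a b γ x‖⁻¹ • der a b g x

/-- The unit tangent `T = dγ/ds`. -/
def unitTangent (a b : ℝ) (γ : ℝ → E3) : ℝ → E3 :=
  arcDer a b γ γ

/-- The bending energy `½ ∫ ϱ ⟨dT/ds, dT/ds⟩ ds`, where `ds = |γ'| dx`. -/
def bendingEnergy (a b : ℝ) (ϱ : ℝ → ℝ) (γ : ℝ → E3) : ℝ :=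
  (1 / 2) * ∫ x in a..b,
    ϱ x * inner ℝ (arcDer a b γ (unitTangent a b γ) x) (arcDer a b γ (unitTangent a b γ) x) *
      ‖der a b γ x‖

/-- `Z` is a parallel normal field along `γ`: it is smooth, `⟨Z, T⟩ = 0`, and `Z' = l T` for some
smooth function `l`. -/
structure IsParallelNormal (a b : ℝ) (γ Z : ℝ → E3) : Prop where
  smooth : SmoothOn a b Z
  normal : ∀ x ∈ Icc a b, inner ℝ (Z x) (unitTangent a b γ x) = 0
  parallel : ∃ l : ℝ → ℝ, SmoothOn a b l ∧
    ∀ x ∈ Icc a b, der a b Z x = l x • unitTangent a b γ x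

/-- The angle `θ ∈ ℝ/2πℤ` is the holonomy of `γ` with respect to the pair of unit vectors
`Wa ∈ T(a)^⊥`, `Wb ∈ T(b)^⊥`: the parallel transport `Z b` of `Wa` along `γ` equals
`cos θ Wb + sin θ T(b) × Wb`. -/
def HasHolonomy (a b : ℝ) (γ : ℝ → E3) (Wa Wb : E3) (θ : Real.Angle) : Prop :=
  (‖Wa‖ = 1 ∧ inner ℝ Wa (unitTangent a b γ a) = 0) ∧
  (‖Wb‖ = 1 ∧ inner ℝ Wb (unitTangent a b γ b) = 0) ∧
  ∃ Z : ℝ → E3, IsParallelNormal a b γ Z ∧ Z a = Wa ∧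
    Z b = θ.cos • Wb + θ.sin • cross (unitTangent a b γ b) Wb

/-- `Γ t`, `t ∈ [-ε, ε]`, is a smooth variation of `γ` with compact support in the interior of
`[a, b]`. -/
structure IsCompactVariation (a b : ℝ) (γ : ℝ → E3) (ε : ℝ) (Γ : ℝ → ℝ → E3) : Prop where
  smooth : ContDiffOn ℝ ∞ (fun p : ℝ × ℝ => Γ p.1 p.2) (Icc (-ε) ε ×ˢ Icc a b)
  start : ∀ x ∈ Icc a b, Γ 0 x = γ x
  support : ∃ δ > 0, ∀ t ∈ Icc (-ε) ε, ∀ x ∈ Icc a b,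
    (x ≤ a + δ ∨ b - δ ≤ x) → Γ t x = γ x

/-- The variation `Γ` of `γ` leaves the arc-length `|γ'|` unchanged at every point. -/
def PreservesArcLength (a b : ℝ) (γ : ℝ → E3) (ε : ℝ) (Γ : ℝ → ℝ → E3) : Prop :=
  ∀ t ∈ Icc (-ε) ε, ∀ x ∈ Icc a b, ‖der a b (Γ t) x‖ = ‖der a b γ x‖

/-- The variation `Γ` of `γ` leaves the holonomy unchanged (with respect to every pair of unit
normal vectors at the end points; the end tangents are fixed by compactly supported variations). -/
def PreservesHolonomy (a b : ℝ) (γ : ℝ → E3) (ε : ℝ) (Γ : ℝ → ℝ → E3) : Prop :=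
  ∀ t ∈ Icc (-ε) ε, ∀ (Wa Wb : E3) (θ : Real.Angle),
    HasHolonomy a b (Γ t) Wa Wb θ ↔ HasHolonomy a b γ Wa Wb θ

/-- `γ` is holonomy constrained elastic with bending stiffness `ϱ`: it is a critical point of the
bending energy under all compactly supported smooth variations which preserve the arc-length and the
holonomy. -/
def IsHolonomyConstrainedElastic (a b : ℝ) (ϱ : ℝ → ℝ) (γ : ℝ → E3) : Prop :=
  ∀ (ε : ℝ) (Γ : ℝ → ℝ → E3), 0 < ε → IsCompactVariation a b γ ε Γ →
    PreservesArcLength a b γ ε Γ → PreservesHolonomy a b γ ε Γ →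
    HasDerivAt (fun t => bendingEnergy a b ϱ (Γ t)) 0 0

end

/-! Write T = γ' and P = ϱT'. A variation that preserves arc length moves T on the unit sphere, and
it fixes both ends of the curve exactly when ∫T is kept. Its velocity has the form U × T.
Integrating the energy by parts, criticality says that ∫⟨U, T × P'⟩ = 0 whenever U × T is the
velocity of an admissible family (`IsHolonomyConstrainedElastic.integral_inner_eq_zero`). The
linearized constraints are four integrals: U against T × eᵢ for closure, and U against -T' for the
holonomy. Once every test field U annihilated by these four is known to be admissible,
`exists_multipliers` yields T × P' = T × 𝐚 - μT', which integrates to the asserted equation because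
T' × P = 0. The pairing in the second claim then equals ϱ²|T'|².

The work lies in realizing such U by families that satisfy the constraints exactly. Take an axis e
that ±T avoids and write T = ρA + ze with A horizontal, of unit length, and A' = k e × A. For fixed
end frames the holonomy depends only on ∫kz (`IsCylindrical.hasHolonomy`). Turning A by α and
raising z by β replaces kz by (k + α')(z + β), so the holonomy constraint is an explicit integral.

If the four constraint densities are linearly independent, dual test fields exist and the implicit
function theorem corrects any linearly admissible direction to an exact family
(`IsHolonomyConstrainedElastic.integral_inner_cylField_eq_zero`).

If they are dependent, either T' = 0, where zero constants do, or T' = w e × T with w ≠ 0, and the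
constraint map is not a submersion. About the axis e, z is constant and k = w; axial closure reads
∫β = 0 and the change of holonomy is ∫(wβ + βα'). Along a fixed ray β = tβ₀ the bilinear term turns
into the linear condition ∫β₀α' = 0, which can be met by adjusting α alone. Directions satisfying it
are called isotropic. Every admissible direction is a sum of two isotropic ones, (α - sη, β) and
(sη, 0), and the first variation is linear. -/

/-! ### Integrals depending smoothly on parameters. -/

section ParametricIntegrals

open MeasureTheory Topology

/-- Integrals over a fixed interval depend smoothly on parameters. -/
theorem contDiffOn_intervalIntegral_param {P F : Type*} [NormedAddCommGroup P] [NormedSpace ℝ P]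
    [NormedAddCommGroup F] [NormedSpace ℝ F] {s : Set P} (hs : IsOpen s)
    {Ψ : P → ℝ → F} (hΨ : ContDiffOn ℝ ∞ (fun q : P × ℝ => Ψ q.1 q.2) (s ×ˢ univ))
    {a b : ℝ} (hab : a ≤ b) :
    ContDiffOn ℝ ∞ (fun p => ∫ x in a..b, Ψ p x) s := by
  -- The integral is the value at 0 of the convolution of the indicator of (a, b] with y ↦ χ(-y) Ψ p
  -- (-y). The cutoff χ, equal to 1 on [a, b], provides a compact support independent of p.
  obtain ⟨χ, hχc, -, hχs, hχ1⟩ := exists_contMDiff_support_eq_eq_one_iff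
    (modelWithCornersSelf ℝ ℝ) (n := (⊤ : ℕ∞)) (s := Ioo (a - 1) (b + 1)) (t := Icc a b) isOpen_Ioo
    isClosed_Icc (fun x hx => ⟨by linarith [hx.1], by linarith [hx.2]⟩)
  have hχ : ContDiff ℝ ∞ χ := hχc.contDiff
  have h := contDiffOn_convolution_right_with_param (μ := MeasureTheory.volume) (n := (⊤ : ℕ∞))
    (ContinuousLinearMap.lsmul ℝ ℝ : ℝ →L[ℝ] F →L[ℝ] F)
    (f := (Ioc a b).indicator (fun _ => (1 : ℝ)))
    (g := fun p y => χ (-y) • Ψ p (-y)) (s := s) (k := Icc (-(b + 1)) (-(a - 1))) hs isCompact_Icc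
    (fun p x _ hx => by
      have : χ (-x) = 0 := by
        by_contra h
        have h' : -x ∈ Function.support χ := h
        rw [hχs] at h'
        exact hx ⟨by linarith [h'.2], by linarith [h'.1]⟩
      simp [this])
    ((integrable_indicator_iff measurableSet_Ioc).2
      (integrableOn_const (by simp))).locallyIntegrable
    (by
      refine ContDiffOn.smul (hχ.comp (contDiff_snd.neg)).contDiffOn ?_
      exact hΨ.comp (contDiff_fst.prodMk contDiff_snd.neg).contDiffOn
        (fun q hq => ⟨hq.1, mem_univ _⟩))
  have h0 : ContDiffOn ℝ ∞ (fun p : P => (p, (0 : ℝ))) s :=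
    contDiffOn_id.prodMk contDiffOn_const
  refine (h.comp h0 (fun p hp => ⟨hp, mem_univ _⟩)).congr (fun p hp => ?_)
  simp only [Function.comp, MeasureTheory.convolution]
  rw [intervalIntegral.integral_of_le hab, ← integral_indicator measurableSet_Ioc]
  congr 1 with x
  by_cases hx : x ∈ Ioc a b
  · have : χ x = 1 := (hχ1 x).1 ⟨hx.1.le, hx.2⟩
    simp [hx, this]
  · simp [hx]

/-- Differentiation under the integral sign for smooth integrands. -/
theorem hasDerivAt_intervalIntegral_param {F : Type*} [NormedAddCommGroup F] [NormedSpace ℝ F]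
    {s : Set ℝ} (hs : IsOpen s) {t₀ : ℝ} (ht₀ : t₀ ∈ s)
    {Ψ : ℝ → ℝ → F} (hΨ : ContDiffOn ℝ ∞ (fun q : ℝ × ℝ => Ψ q.1 q.2) (s ×ˢ univ))
    {Ψ' : ℝ → F} {a b : ℝ}
    (hΨ' : ∀ x, HasDerivAt (fun t => Ψ t x) (Ψ' x) t₀) :
    HasDerivAt (fun t => ∫ x in a..b, Ψ t x) (∫ x in a..b, Ψ' x) t₀ := by
  have hso : IsOpen (s ×ˢ (univ : Set ℝ)) := hs.prod isOpen_univ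
  obtain ⟨η, hη, hηs⟩ := Metric.nhds_basis_closedBall.mem_iff.1 (hs.mem_nhds ht₀)
  have hfd : ContinuousOn (fun q : ℝ × ℝ => fderiv ℝ (fun q : ℝ × ℝ => Ψ q.1 q.2) q (1, 0))
      (s ×ˢ univ) :=
    (hΨ.continuousOn_fderiv_of_isOpen hso (by simp)).clm_apply continuousOn_const
  have hder : ∀ t ∈ s, ∀ x, HasDerivAt (fun t => Ψ t x)
      (fderiv ℝ (fun q : ℝ × ℝ => Ψ q.1 q.2) (t, x) (1, 0)) t := fun t ht x => by
    have h1 : HasFDerivAt (fun q : ℝ × ℝ => Ψ q.1 q.2)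
        (fderiv ℝ (fun q : ℝ × ℝ => Ψ q.1 q.2) (t, x)) (t, x) :=
      ((hΨ.contDiffAt (hso.mem_nhds ⟨ht, mem_univ _⟩)).differentiableAt (by simp)).hasFDerivAt
    exact h1.comp_hasDerivAt t ((hasDerivAt_id t).prodMk (hasDerivAt_const t x))
  have hslice : ∀ t ∈ s, Continuous (fun x => Ψ t x) := fun t ht =>
    continuousOn_univ.1 (hΨ.continuousOn.comp
      (continuous_const.prodMk continuous_id).continuousOn (fun x _ => ⟨ht, mem_univ _⟩))
  have hslice' : Continuous
      (fun x => fderiv ℝ (fun q : ℝ × ℝ => Ψ q.1 q.2) (t₀, x) (1, 0)) :=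
    continuousOn_univ.1 (hfd.comp
      (continuous_const.prodMk continuous_id).continuousOn (fun x _ => ⟨ht₀, mem_univ _⟩))
  obtain ⟨C, hC⟩ := ((isCompact_closedBall t₀ η).prod (isCompact_uIcc (a := a) (b := b))
    ).exists_bound_of_continuousOn (hfd.mono (prod_mono hηs (subset_univ _)))
  have key := (intervalIntegral.hasDerivAt_integral_of_dominated_loc_of_deriv_le (μ := volume)
    (F := Ψ) (F' := fun t x => fderiv ℝ (fun q : ℝ × ℝ => Ψ q.1 q.2) (t, x) (1, 0))
    (a := a) (b := b) (bound := fun _ => C) (Metric.closedBall_mem_nhds t₀ hη)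
    (by
      filter_upwards [hs.mem_nhds ht₀] with t ht
      exact (hslice t ht).aestronglyMeasurable)
    ((hslice t₀ ht₀).intervalIntegrable _ _)
    hslice'.aestronglyMeasurable
    (.of_forall fun x hx t ht => hC (t, x) ⟨ht, uIoc_subset_uIcc hx⟩)
    (by simp)
    (.of_forall fun x _ t ht => hder t (hηs ht) x)).2
  convert key using 3 with x
  exact (hΨ' x).unique (hder t₀ ht₀ x)

/-- The primitive of a smooth parameter dependent function is jointly smooth. -/
theorem contDiffOn_primitive_param {P F : Type*} [NormedAddCommGroup P] [NormedSpace ℝ P]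
    [NormedAddCommGroup F] [NormedSpace ℝ F] {s : Set P} (hs : IsOpen s)
    {D : P → ℝ → F} (hD : ContDiffOn ℝ ∞ (fun q : P × ℝ => D q.1 q.2) (s ×ˢ univ)) (a : ℝ) :
    ContDiffOn ℝ ∞ (fun q : P × ℝ => ∫ y in a..q.2, D q.1 y) (s ×ˢ univ) := by
  -- The substitution y = a + (x - a)u moves the variable end point into the integrand, over the
  -- fixed interval [0, 1].
  have h := contDiffOn_intervalIntegral_param (P := P × ℝ) (hs.prod (isOpen_univ (X := ℝ)))
    (Ψ := fun q u => (q.2 - a) • D q.1 (a + (q.2 - a) * u)) (a := 0) (b := 1)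
    (by
      refine ContDiffOn.smul ?_ ?_
      · exact ContDiff.contDiffOn (by fun_prop)
      · exact hD.comp (g := fun q : P × ℝ => D q.1 q.2)
          (f := fun q : (P × ℝ) × ℝ => (q.1.1, a + (q.1.2 - a) * q.2))
          (ContDiff.contDiffOn (by fun_prop)) (fun q hq => ⟨hq.1.1, mem_univ _⟩)) zero_le_one
  refine h.congr (fun q _ => ?_)
  simp only [intervalIntegral.integral_smul]
  have := intervalIntegral.smul_integral_comp_add_mul (f := fun y => D q.1 y)
    (a := 0) (b := 1) (q.2 - a) a
  simp only [mul_zero, add_zero, mul_one, add_sub_cancel] at this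
  exact this.symm

/-- A function that is smooth over an open interval and vanishes off a closed subset of it is
smooth everywhere. -/
theorem contDiffOn_prod_univ_of_eq_zero {P F : Type*} [NormedAddCommGroup P] [NormedSpace ℝ P]
    [NormedAddCommGroup F] [NormedSpace ℝ F] {s : Set P} (hs : IsOpen s) {U K : Set ℝ}
    (hU : IsOpen U) (hK : IsClosed K) (hKU : K ⊆ U) {G : P × ℝ → F}
    (hG : ContDiffOn ℝ ∞ G (s ×ˢ U)) (h0 : ∀ p ∈ s, ∀ x ∉ K, G (p, x) = 0) :
    ContDiffOn ℝ ∞ G (s ×ˢ univ) := by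
  rintro ⟨p, x⟩ ⟨hp, -⟩
  by_cases hx : x ∈ U
  · exact (hG.contDiffAt ((hs.prod hU).mem_nhds ⟨hp, hx⟩)).contDiffWithinAt
  · refine ContDiffAt.contDiffWithinAt ((contDiffAt_const (c := (0 : F))).congr_of_eventuallyEq ?_)
    filter_upwards [(hs.prod hK.isOpen_compl).mem_nhds ⟨hp, fun h => hx (hKU h)⟩] with q hq
    exact h0 q.1 hq.1 q.2 hq.2

theorem contDiff_of_eq_zero {F : Type*} [NormedAddCommGroup F] [NormedSpace ℝ F] {U K : Set ℝ}
    (hU : IsOpen U) (hK : IsClosed K) (hKU : K ⊆ U) {G : ℝ → F}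
    (hG : ContDiffOn ℝ ∞ G U) (h0 : ∀ x ∉ K, G x = 0) : ContDiff ℝ ∞ G := by
  rw [contDiff_iff_contDiffAt]
  intro x
  by_cases hx : x ∈ U
  · exact hG.contDiffAt (hU.mem_nhds hx)
  · refine (contDiffAt_const (c := (0 : F))).congr_of_eventuallyEq ?_
    filter_upwards [hK.isOpen_compl.mem_nhds fun h => hx (hKU h)] with y hy
    exact h0 y hy

end ParametricIntegrals

/-! ### Solving constraints along a curve. -/

section ImplicitCurve

open Topology

/-- A smooth map `f : ℝ × G → G` with `f 0 = 0` whose derivative at `0` is the second projection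
vanishes along a smooth curve through `0` tangent to the first axis. -/
theorem exists_curve_of_hasFDerivAt_snd {G : Type*} [NormedAddCommGroup G] [NormedSpace ℝ G]
    [CompleteSpace G] {s : Set (ℝ × G)} (hs : IsOpen s) (h0 : (0 : ℝ × G) ∈ s)
    {f : ℝ × G → G} (hf : ContDiffOn ℝ ∞ f s) (hf0 : f 0 = 0)
    (hf' : HasFDerivAt f (ContinuousLinearMap.snd ℝ ℝ G) 0) :
    ∃ ε > 0, ∃ g : ℝ → G, ContDiffOn ℝ ∞ g (Ioo (-ε) ε) ∧ g 0 = 0 ∧ HasDerivAt g 0 0 ∧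
      ∀ t ∈ Ioo (-ε) ε, (t, g t) ∈ s ∧ f (t, g t) = 0 := by
  -- Inverse function theorem for Φ, whose derivative at 0 is the identity: g t is the second
  -- component of Φ⁻¹(t, 0), and g' 0 = 0 because Φ⁻¹ also has the identity as derivative.
  set Φ : ℝ × G → ℝ × G := fun p => (p.1, f p) with hΦ
  have hΦs : ContDiffOn ℝ ∞ Φ s := contDiff_fst.contDiffOn.prodMk hf
  have hΦ0 : ContDiffAt ℝ ∞ Φ 0 := hΦs.contDiffAt (hs.mem_nhds h0)
  have hΦ' : HasFDerivAt Φ ((ContinuousLinearEquiv.refl ℝ (ℝ × G) : ℝ × G →L[ℝ] ℝ × G)) 0 := by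
    have := (hasFDerivAt_fst (𝕜 := ℝ) (p := (0 : ℝ × G))).prodMk hf'
    exact this.congr_fderiv rfl
  set e := hΦ0.toOpenPartialHomeomorph Φ hΦ' (by simp) with he
  have hee : ∀ p, e p = Φ p := fun p => rfl
  have h0e : (0 : ℝ × G) ∈ e.source := hΦ0.mem_toOpenPartialHomeomorph_source hΦ' (by simp)
  have hΦ00 : Φ 0 = 0 := by simp [hΦ, hf0]
  have h0t : (0 : ℝ × G) ∈ e.target := by
    have := e.map_source h0e
    rwa [hee, hΦ00] at this
  have hsymm0 : e.symm 0 = 0 := by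
    have := e.left_inv h0e
    rwa [hee, hΦ00] at this
  -- the derivative of `Φ` is invertible near `0`
  have hunit : ∀ᶠ p in 𝓝 (0 : ℝ × G), p ∈ s ∧
      ∃ A : (ℝ × G) ≃L[ℝ] (ℝ × G), HasFDerivAt Φ (A : ℝ × G →L[ℝ] ℝ × G) p := by
    have hc : ContinuousAt (fun p => fderiv ℝ Φ p) 0 :=
      (hΦs.continuousOn_fderiv_of_isOpen hs (by simp)).continuousAt (hs.mem_nhds h0)
    have hmem : range ((↑) : ((ℝ × G) ≃L[ℝ] (ℝ × G)) → (ℝ × G →L[ℝ] ℝ × G)) ∈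
        𝓝 (fderiv ℝ Φ 0) := by
      rw [hΦ'.fderiv]
      exact ContinuousLinearEquiv.nhds _
    filter_upwards [hc.preimage_mem_nhds hmem, hs.mem_nhds h0] with p hp hps
    obtain ⟨A, hA⟩ := hp
    refine ⟨hps, A, ?_⟩
    rw [hA]
    exact ((hΦs.contDiffAt (hs.mem_nhds hps)).differentiableAt (by simp)).hasFDerivAt
  have hsc : ContinuousAt e.symm 0 := e.continuousAt_symm h0t
  have hpull : ∀ᶠ q in 𝓝 (0 : ℝ × G), e.symm q ∈ s ∧
      ∃ A : (ℝ × G) ≃L[ℝ] (ℝ × G), HasFDerivAt Φ (A : ℝ × G →L[ℝ] ℝ × G) (e.symm q) := by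
    have := hsc.tendsto
    rw [hsymm0] at this
    exact this.eventually hunit
  have hι : ContinuousAt (fun t : ℝ => (t, (0 : G))) 0 := by fun_prop
  have hev : ∀ᶠ t in 𝓝 (0 : ℝ), (t, (0 : G)) ∈ e.target ∧ (e.symm (t, 0) ∈ s ∧
      ∃ A : (ℝ × G) ≃L[ℝ] (ℝ × G),
        HasFDerivAt Φ (A : ℝ × G →L[ℝ] ℝ × G) (e.symm (t, 0))) :=
    hι.tendsto.eventually ((e.open_target.eventually_mem h0t).and hpull)
  obtain ⟨ε, hε, hball⟩ := Metric.eventually_nhds_iff.1 hev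
  have hP : ∀ t ∈ Ioo (-ε) ε, (t, (0 : G)) ∈ e.target ∧ (e.symm (t, 0) ∈ s ∧
      ∃ A : (ℝ × G) ≃L[ℝ] (ℝ × G),
        HasFDerivAt Φ (A : ℝ × G →L[ℝ] ℝ × G) (e.symm (t, 0))) := fun t ht => by
    apply hball
    rw [Real.dist_eq, sub_zero, abs_lt]
    exact ht
  -- The inverse is smooth at each point where the derivative of Φ is invertible, so ε was chosen to
  -- keep the whole segment over such points.
  have hsm : ∀ t ∈ Ioo (-ε) ε, ContDiffAt ℝ ∞ e.symm (t, (0 : G)) := fun t ht => by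
    obtain ⟨h1, h2, A, hA⟩ := hP t ht
    exact e.contDiffAt_symm h1 hA (hΦs.contDiffAt (hs.mem_nhds h2))
  have hright : ∀ t ∈ Ioo (-ε) ε, Φ (e.symm (t, 0)) = (t, 0) := fun t ht =>
    e.right_inv (hP t ht).1
  refine ⟨ε, hε, fun t => (e.symm (t, 0)).2, ?_, congrArg Prod.snd hsymm0, ?_, ?_⟩
  · intro t ht
    have h1 : ContDiffAt ℝ ∞ (fun t : ℝ => (t, (0 : G))) t := by fun_prop
    exact ((contDiff_snd.contDiffAt.comp t ((hsm t ht).comp t h1))).contDiffWithinAt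
  · have h1 : HasFDerivAt e.symm
        ((ContinuousLinearEquiv.refl ℝ (ℝ × G)).symm : ℝ × G →L[ℝ] ℝ × G) 0 :=
      e.hasFDerivAt_symm h0t (by rw [hsymm0]; exact hΦ')
    have h2 : HasDerivAt (fun t : ℝ => (t, (0 : G))) (1, 0) 0 :=
      (hasDerivAt_id 0).prodMk (hasDerivAt_const 0 0)
    have h3 := h1.comp_hasDerivAt (x := (0 : ℝ)) (f := fun t : ℝ => (t, (0 : G))) h2
    exact (hasFDerivAt_snd (p := e.symm (0, 0))).comp_hasDerivAt (0 : ℝ) h3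
  · intro t ht
    have hr := hright t ht
    have h1 : (e.symm (t, 0)).1 = t := congrArg Prod.fst hr
    have h2 : (t, (e.symm (t, 0)).2) = e.symm (t, 0) := Prod.ext h1.symm rfl
    dsimp only
    rw [h2]
    exact ⟨(hP t ht).2.1, congrArg Prod.snd hr⟩

end ImplicitCurve

/-! ### Test functions, dual families and Lagrange multipliers. -/

section TestFunctions

open MeasureTheory

variable {F : Type*} [NormedAddCommGroup F] [InnerProductSpace ℝ F]

/-- Smooth functions with compact support in the open interval `(a, b)`. -/
def testSpace (a b : ℝ) (F : Type*) [NormedAddCommGroup F] [NormedSpace ℝ F] :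
    Submodule ℝ (ℝ → F) where
  carrier := {U | ContDiff ℝ ∞ U ∧ tsupport U ⊆ Ioo a b}
  add_mem' hU hV := ⟨hU.1.add hV.1, (tsupport_add _ _).trans (union_subset hU.2 hV.2)⟩
  zero_mem' := ⟨contDiff_zero_fun, by simp [tsupport]⟩
  smul_mem' c U hU := ⟨hU.1.const_smul c,
    (tsupport_smul_subset_right (fun _ => c) U).trans hU.2⟩

theorem testSpace.hasCompactSupport {F : Type*} [NormedAddCommGroup F] [NormedSpace ℝ F]
    {a b : ℝ} {U : ℝ → F} (hU : U ∈ testSpace a b F) :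
    HasCompactSupport U :=
  isCompact_Icc.of_isClosed_subset (isClosed_tsupport U) (hU.2.trans Ioo_subset_Icc_self)

/-- The functional `U ↦ ∫ ⟨U, f⟩` on test functions. -/
noncomputable def pairing {a b : ℝ} (hab : a ≤ b) {f : ℝ → F} (hf : ContinuousOn f (Icc a b)) :
    testSpace a b F →ₗ[ℝ] ℝ where
  toFun U := ∫ x in a..b, inner ℝ (U.1 x) (f x)
  map_add' U V := by
    have h : ∀ W : testSpace a b F,
        IntervalIntegrable (fun x => inner ℝ (W.1 x) (f x)) volume a b := fun W =>
      ContinuousOn.intervalIntegrable (by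
        rw [uIcc_of_le hab]; exact W.2.1.continuous.continuousOn.inner hf)
    rw [← intervalIntegral.integral_add (h U) (h V)]
    simp [inner_add_left]
  map_smul' c U := by
    simp [inner_smul_left]

/-- The fundamental lemma of the calculus of variations on an interval. -/
theorem eqOn_zero_of_forall_integral_inner_eq_zero [FiniteDimensional ℝ F] {a b : ℝ} (hab : a ≤ b)
    {f : ℝ → F}
    (hf : ContinuousOn f (Icc a b))
    (h : ∀ U ∈ testSpace a b F, ∫ x in a..b, inner ℝ (U x) (f x) = 0) :
    ∀ x ∈ Ioo a b, f x = 0 := by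
  have hfo : ContinuousOn f (Ioo a b) := hf.mono Ioo_subset_Icc_self
  have hae := isOpen_Ioo.ae_eq_zero_of_integral_contDiff_smul_eq_zero (μ := volume)
    (hfo.locallyIntegrableOn measurableSet_Ioo) (fun g hg hgc hgs => by
      have hint : Integrable (fun x => g x • f x) := by
        have hc : Continuous (fun x => g x • f x) := by
          rw [continuous_iff_continuousAt]
          intro x
          by_cases hx : x ∈ tsupport g
          · exact hg.continuous.continuousAt.smul
              (hfo.continuousAt (isOpen_Ioo.mem_nhds (hgs hx)))
          · refine (continuousAt_const (y := (0 : F))).congr ?_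
            filter_upwards [(isClosed_tsupport g).isOpen_compl.mem_nhds hx] with y hy
            rw [image_eq_zero_of_notMem_tsupport hy, zero_smul]
        exact hc.integrable_of_hasCompactSupport hgc.smul_right
      refine ext_inner_left ℝ fun v => ?_
      rw [← integral_inner hint, inner_zero_right]
      have hU : (fun x => g x • v) ∈ testSpace a b F :=
        ⟨hg.smul contDiff_const, (tsupport_smul_subset_left _ _).trans hgs⟩
      rw [← h _ hU, intervalIntegral.integral_of_le hab, ← setIntegral_eq_integral_of_forall_compl_eq_zero]
      · refine setIntegral_congr_fun measurableSet_Ioc (fun x _ => ?_)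
        simp [inner_smul_left, inner_smul_right]
      · intro x hx
        have : g x = 0 := image_eq_zero_of_notMem_tsupport
          fun hx' => hx ⟨(hgs hx').1, (hgs hx').2.le⟩
        simp [this])
  have h2 : f =ᵐ[volume.restrict (Ioo a b)] fun _ => (0 : F) :=
    (ae_restrict_iff' measurableSet_Ioo).2 hae
  exact Measure.eqOn_open_of_ae_eq h2 isOpen_Ioo hfo continuousOn_const

/-- Linearly independent densities admit dual test functions. -/
theorem exists_dual_testFunctions [FiniteDimensional ℝ F] {a b : ℝ} (hab : a ≤ b)
    {ι : Type*} [Fintype ι] [DecidableEq ι] {f : ι → ℝ → F}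
    (hf : ∀ i, ContinuousOn (f i) (Icc a b))
    (hind : ∀ c : ι → ℝ, (∀ x ∈ Ioo a b, ∑ i, c i • f i x = 0) → c = 0) :
    ∃ U : ι → ℝ → F, (∀ j, U j ∈ testSpace a b F) ∧
      ∀ i j, ∫ x in a..b, inner ℝ (U j x) (f i x) = if i = j then 1 else 0 := by
  set L : testSpace a b F →ₗ[ℝ] (ι → ℝ) := LinearMap.pi fun i => pairing hab (hf i) with hL
  -- A nonzero functional annihilating the range would, by the fundamental lemma, have as
  -- coefficients a linear relation among the densities.
  have hsurj : LinearMap.range L = ⊤ := by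
    by_contra hne
    obtain ⟨φ, hφ, hφL⟩ := Submodule.exists_le_ker_of_lt_top _ (lt_top_iff_ne_top.2 hne)
    have hφc : ∀ y : ι → ℝ, φ y = ∑ i, y i * φ (Pi.single i 1) := fun y => by
      conv_lhs => rw [pi_eq_sum_univ' y]
      simp [map_sum]
    have hc := hind (fun i => φ (Pi.single i 1)) (by
      refine eqOn_zero_of_forall_integral_inner_eq_zero hab
        (continuousOn_finsetSum _ fun i _ => (hf i).const_smul _) fun U hU => ?_
      have h1 : φ (L ⟨U, hU⟩) = 0 := hφL ⟨_, rfl⟩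
      rw [hφc] at h1
      rw [← h1]
      simp only [inner_sum, inner_smul_right]
      rw [intervalIntegral.integral_finsetSum]
      · simp [hL, pairing, mul_comm]
      · intro i _
        refine ContinuousOn.intervalIntegrable ?_
        rw [uIcc_of_le hab]
        exact continuousOn_const.mul (hU.1.continuous.continuousOn.inner (hf i)))
    refine hφ (LinearMap.ext fun y => ?_)
    rw [hφc]
    simp [fun i => congrFun hc i]
  rw [LinearMap.range_eq_top] at hsurj
  choose U hU using fun j : ι => hsurj (Pi.single j 1)
  refine ⟨fun j => (U j).1, fun j => (U j).2, fun i j => ?_⟩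
  have := congrFun (hU j) i
  rw [Pi.single_apply] at this
  exact this

/-- Lagrange multipliers for densities. -/
theorem exists_multipliers [FiniteDimensional ℝ F] {a b : ℝ} (hab : a ≤ b)
    {ι : Type*} [Fintype ι] {f : ι → ℝ → F} {g : ℝ → F}
    (hf : ∀ i, ContinuousOn (f i) (Icc a b)) (hg : ContinuousOn g (Icc a b))
    (h : ∀ U ∈ testSpace a b F, (∀ i, ∫ x in a..b, inner ℝ (U x) (f i x) = 0) →
      ∫ x in a..b, inner ℝ (U x) (g x) = 0) :
    ∃ c : ι → ℝ, ∀ x ∈ Ioo a b, g x = ∑ i, c i • f i x := by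
  -- A functional vanishing on the common kernel of finitely many functionals lies in their span;
  -- the fundamental lemma turns this into an identity of densities.
  have hspan := mem_span_of_iInf_ker_le_ker (L := fun i => pairing hab (hf i))
    (K := pairing hab hg) (fun U hU => by
      simp only [Submodule.mem_iInf, LinearMap.mem_ker] at hU ⊢
      exact h U.1 U.2 hU)
  obtain ⟨c, hc⟩ := (Submodule.mem_span_range_iff_exists_fun ℝ).1 hspan
  refine ⟨c, fun x hx => sub_eq_zero.1 ?_⟩
  refine eqOn_zero_of_forall_integral_inner_eq_zero hab (f := fun x => g x - ∑ i, c i • f i x)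
    (hg.sub (continuousOn_finsetSum _ fun i _ => (hf i).const_smul _)) (fun U hU => ?_) x hx
  have h1 := LinearMap.congr_fun hc ⟨U, hU⟩
  have hii : ∀ i, IntervalIntegrable (fun x => c i * inner ℝ (U x) (f i x)) volume a b :=
    fun i => ContinuousOn.intervalIntegrable (by
      rw [uIcc_of_le hab]
      exact continuousOn_const.mul (hU.1.continuous.continuousOn.inner (hf i)))
  simp only [inner_sub_right, inner_sum, inner_smul_right]
  rw [intervalIntegral.integral_sub, intervalIntegral.integral_finsetSum fun i _ => hii i]
  · simp [pairing] at h1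
    simp [h1]
  · refine ContinuousOn.intervalIntegrable ?_
    rw [uIcc_of_le hab]
    exact hU.1.continuous.continuousOn.inner hg
  · simpa only [Finset.sum_fn] using IntervalIntegrable.sum Finset.univ (fun i _ => hii i)

end TestFunctions

/-! ### Algebra of the cross product. -/

section Cross

@[simp] theorem cross_apply_zero (u v : E3) : cross u v 0 = u 1 * v 2 - u 2 * v 1 := by
  simp [cross, cross_apply]

@[simp] theorem cross_apply_one (u v : E3) : cross u v 1 = u 2 * v 0 - u 0 * v 2 := by
  simp [cross, cross_apply]

@[simp] theorem cross_apply_two (u v : E3) : cross u v 2 = u 0 * v 1 - u 1 * v 0 := by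
  simp [cross, cross_apply]

theorem inner_eq_sum_coord (u v : E3) : inner ℝ u v = u 0 * v 0 + u 1 * v 1 + u 2 * v 2 := by
  simp [PiLp.inner_apply, Fin.sum_univ_three, mul_comm]

theorem E3.ext_coord {u v : E3} (h0 : u 0 = v 0) (h1 : u 1 = v 1) (h2 : u 2 = v 2) : u = v := by
  ext i; fin_cases i <;> assumption

/-- The cross product as a continuous bilinear map. -/
noncomputable def crossL : E3 →L[ℝ] E3 →L[ℝ] E3 :=
  LinearMap.toContinuousLinearMap (LinearMap.toContinuousLinearMap.toLinearMap ∘ₗ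
    LinearMap.mk₂ ℝ cross
      (fun _ _ _ => by apply E3.ext_coord <;> simp <;> ring)
      (fun _ _ _ => by apply E3.ext_coord <;> simp <;> ring)
      (fun _ _ _ => by apply E3.ext_coord <;> simp <;> ring)
      (fun _ _ _ => by apply E3.ext_coord <;> simp <;> ring))

theorem crossL_apply (u v : E3) : crossL u v = cross u v := rfl

theorem ContDiffOn.cross {P : Type*} [NormedAddCommGroup P] [NormedSpace ℝ P] {s : Set P}
    {f g : P → E3} (hf : ContDiffOn ℝ ∞ f s) (hg : ContDiffOn ℝ ∞ g s) :
    ContDiffOn ℝ ∞ (fun p => cross (f p) (g p)) s :=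
  crossL.isBoundedBilinearMap.contDiff.comp_contDiffOn (hf.prodMk hg)

theorem HasDerivWithinAt.cross {f g : ℝ → E3} {f' g' : E3} {s : Set ℝ} {x : ℝ}
    (hf : HasDerivWithinAt f f' s x) (hg : HasDerivWithinAt g g' s x) :
    HasDerivWithinAt (fun y => cross (f y) (g y)) (cross f' (g x) + cross (f x) g') s x := by
  have := (crossL.isBoundedBilinearMap.hasFDerivAt (f x, g x)).comp_hasDerivWithinAt x
    (hf.prodMk hg)
  rw [add_comm]
  exact this

theorem cross_add_left (u v w : E3) : cross (u + v) w = cross u w + cross v w := by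
  simp [← crossL_apply]

theorem cross_add_right (u v w : E3) : cross u (v + w) = cross u v + cross u w := by
  simp [← crossL_apply]

theorem cross_sub_right (u v w : E3) : cross u (v - w) = cross u v - cross u w := by
  simp [← crossL_apply]

theorem cross_smul_left (c : ℝ) (u v : E3) : cross (c • u) v = c • cross u v := by
  simp [← crossL_apply]

theorem cross_smul_right (c : ℝ) (u v : E3) : cross u (c • v) = c • cross u v := by
  simp [← crossL_apply]

@[simp] theorem cross_zero_left (u : E3) : cross 0 u = 0 := by
  simp [← crossL_apply]

@[simp] theorem cross_zero_right (u : E3) : cross u 0 = 0 := by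
  simp [← crossL_apply]

@[simp] theorem cross_self_eq_zero (u : E3) : cross u u = 0 := by
  apply E3.ext_coord <;> simp <;> ring

theorem cross_swap (u v : E3) : cross u v = -cross v u := by
  apply E3.ext_coord <;> simp <;> ring

theorem inner_cross_cyclic (u v w : E3) : inner ℝ u (cross v w) = inner ℝ (cross u v) w := by
  simp only [inner_eq_sum_coord, cross_apply_zero, cross_apply_one, cross_apply_two]; ring

@[simp] theorem inner_cross_self_left (u v : E3) : inner ℝ u (cross u v) = 0 := by
  simp only [inner_eq_sum_coord, cross_apply_zero, cross_apply_one, cross_apply_two]; ring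

@[simp] theorem inner_cross_self_right (u v : E3) : inner ℝ u (cross v u) = 0 := by
  simp only [inner_eq_sum_coord, cross_apply_zero, cross_apply_one, cross_apply_two]; ring

theorem cross_cross_left (u v w : E3) :
    cross u (cross v w) = inner ℝ u w • v - inner ℝ u v • w := by
  apply E3.ext_coord <;> simp [inner_eq_sum_coord] <;> ring

theorem cross_cross_right (u v w : E3) :
    cross (cross u v) w = inner ℝ u w • v - inner ℝ v w • u := by
  apply E3.ext_coord <;> simp [inner_eq_sum_coord] <;> ring

theorem inner_cross_cross (u v w y : E3) :
    inner ℝ (cross u v) (cross w y) = inner ℝ u w * inner ℝ v y - inner ℝ u y * inner ℝ v w := by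
  simp only [inner_eq_sum_coord, cross_apply_zero, cross_apply_one, cross_apply_two]; ring

end Cross

/-! ### Calculus of smooth functions on a closed interval. -/

section Derivative

open MeasureTheory

variable {F : Type*} [NormedAddCommGroup F] [NormedSpace ℝ F] {a b : ℝ}

theorem SmoothOn.hasDerivWithinAt {g : ℝ → F} (hg : SmoothOn a b g) {x : ℝ} (hx : x ∈ Icc a b) :
    HasDerivWithinAt g (der a b g x) (Icc a b) x :=
  ((hg.differentiableOn (by simp)) x hx).hasDerivWithinAt

theorem SmoothOn.hasDerivAt {g : ℝ → F} (hg : SmoothOn a b g) {x : ℝ} (hx : x ∈ Ioo a b) :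
    HasDerivAt g (der a b g x) x :=
  (hg.hasDerivWithinAt (Ioo_subset_Icc_self hx)).hasDerivAt (Icc_mem_nhds hx.1 hx.2)

theorem HasDerivWithinAt.der_eq (hab : a < b) {g : ℝ → F} {g' : F} {x : ℝ}
    (h : HasDerivWithinAt g g' (Icc a b) x) (hx : x ∈ Icc a b) : der a b g x = g' :=
  h.derivWithin (uniqueDiffOn_Icc hab x hx)

theorem SmoothOn.smoothOn_der (hab : a < b) {g : ℝ → F} (hg : SmoothOn a b g) :
    SmoothOn a b (der a b g) :=
  ((contDiffOn_infty_iff_derivWithin (uniqueDiffOn_Icc hab)).1 hg).2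

theorem der_congr {f g : ℝ → F} (h : ∀ x ∈ Icc a b, f x = g x) {x : ℝ} (hx : x ∈ Icc a b) :
    der a b f x = der a b g x :=
  derivWithin_congr h (h x hx)

theorem SmoothOn.of_hasDerivWithinAt (hab : a < b) {f g : ℝ → F} (hg : SmoothOn a b g)
    (h : ∀ x ∈ Icc a b, HasDerivWithinAt f (g x) (Icc a b) x) : SmoothOn a b f :=
  (contDiffOn_infty_iff_derivWithin (uniqueDiffOn_Icc hab)).2
    ⟨fun x hx => (h x hx).differentiableWithinAt,
      ContDiffOn.congr (f₁ := derivWithin f (Icc a b)) hg fun x hx => (h x hx).der_eq hab hx⟩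

theorem SmoothOn.hasDerivWithinAt_primitive [CompleteSpace F] {f : ℝ → F} (hf : SmoothOn a b f)
    {x : ℝ} (hx : x ∈ Icc a b) :
    HasDerivWithinAt (fun x => ∫ y in a..x, f y) (f x) (Icc a b) x := by
  have hc : ContinuousOn f (Icc a b) := hf.continuousOn
  have : Fact (x ∈ Icc a b) := ⟨hx⟩
  refine intervalIntegral.integral_hasDerivWithinAt_right (s := Icc a b) (t := Icc a b) ?_ ?_
    (hc x hx)
  · refine ContinuousOn.intervalIntegrable (hc.mono ?_)
    rw [uIcc_of_le hx.1]
    exact Icc_subset_Icc_right hx.2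
  · exact ⟨Icc a b, self_mem_nhdsWithin, hc.aestronglyMeasurable measurableSet_Icc⟩

theorem SmoothOn.smoothOn_primitive [CompleteSpace F] (hab : a < b) {f : ℝ → F} (hf : SmoothOn a b f) :
    SmoothOn a b (fun x => ∫ y in a..x, f y) :=
  hf.of_hasDerivWithinAt hab fun _ hx => hf.hasDerivWithinAt_primitive hx

theorem SmoothOn.integral_der [CompleteSpace F] (hab : a < b) {f : ℝ → F} (hf : SmoothOn a b f) :
    ∫ x in a..b, der a b f x = f b - f a :=
  intervalIntegral.integral_eq_sub_of_hasDerivAt_of_le hab.le hf.continuousOn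
    (fun _ hx => hf.hasDerivAt hx)
    (ContinuousOn.intervalIntegrable (by
      rw [uIcc_of_le hab.le]; exact (hf.smoothOn_der hab).continuousOn))

theorem SmoothOn.intervalIntegrable (hab : a < b) {f : ℝ → F} (hf : SmoothOn a b f) :
    IntervalIntegrable f volume a b :=
  ContinuousOn.intervalIntegrable (by rw [uIcc_of_le hab.le]; exact hf.continuousOn)

end Derivative

/-! ### Cylindrical coordinates of the tangent and the holonomy. -/

section Cylindrical

variable {a b : ℝ}

/-- Two orthogonal unit vectors and their cross product form an orthonormal basis. -/
theorem orthonormal_expansion {e A : E3} (he : inner ℝ e e = 1) (hA : inner ℝ A A = 1)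
    (hAe : inner ℝ A e = 0) (v : E3) :
    v = inner ℝ v e • e + inner ℝ v A • A + inner ℝ v (cross e A) • cross e A := by
  have heA : inner ℝ e A = 0 := by rw [real_inner_comm]; exact hAe
  -- With n = e × A, the vector n × (v × n) is computed twice: as the part of v orthogonal to n, and
  -- as a combination of e and A.
  have h1 : cross (cross e A) (cross v (cross e A)) = v - inner ℝ v (cross e A) • cross e A := by
    rw [cross_cross_left, inner_cross_cross, he, hA, heA, hAe, real_inner_comm v]
    simp
  have h2 : cross (cross e A) (cross v (cross e A)) = inner ℝ v e • e + inner ℝ v A • A := by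
    rw [cross_cross_left v, cross_sub_right, cross_smul_right, cross_smul_right, cross_cross_right,
      cross_cross_right, he, hA, heA, hAe]
    module
  rw [← h2, h1]
  module

/-- `T = ρ A + z e` are cylindrical coordinates about the axis `e` of the unit vector field `T`:
`A` is a horizontal unit field turning at the rate `k`. -/
structure IsCylindrical (a b : ℝ) (T : ℝ → E3) (e : E3) (A : ℝ → E3) (ρ z k : ℝ → ℝ) : Prop where
  axis : inner ℝ e e = 1
  smooth_A : SmoothOn a b A
  smooth_ρ : SmoothOn a b ρ
  smooth_z : SmoothOn a b z
  smooth_k : SmoothOn a b k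
  unit : ∀ x ∈ Icc a b, inner ℝ (A x) (A x) = 1
  horizontal : ∀ x ∈ Icc a b, inner ℝ (A x) e = 0
  pos : ∀ x ∈ Icc a b, 0 < ρ x
  sq_add_sq : ∀ x ∈ Icc a b, ρ x ^ 2 + z x ^ 2 = 1
  eq : ∀ x ∈ Icc a b, T x = ρ x • A x + z x • e
  deriv_A : ∀ x ∈ Icc a b, HasDerivWithinAt A (k x • cross e (A x)) (Icc a b) x

namespace IsCylindrical

variable {T : ℝ → E3} {e : E3} {A : ℝ → E3} {ρ z k : ℝ → ℝ}

theorem deriv_n (h : IsCylindrical a b T e A ρ z k) {x : ℝ} (hx : x ∈ Icc a b) :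
    HasDerivWithinAt (fun x => cross e (A x)) (-k x • A x) (Icc a b) x := by
  have h1 := (hasDerivWithinAt_const x (Icc a b) e).cross (h.deriv_A x hx)
  have heA : inner ℝ e (A x) = 0 := by rw [real_inner_comm]; exact h.horizontal x hx
  rw [cross_zero_left, cross_smul_right, cross_cross_left, h.axis, heA] at h1
  refine h1.congr_deriv ?_
  module

theorem deriv_ρ (hab : a < b) (h : IsCylindrical a b T e A ρ z k) {x : ℝ} (hx : x ∈ Icc a b) :
    ρ x * der a b ρ x + z x * der a b z x = 0 := by
  have h1 := ((h.smooth_ρ.hasDerivWithinAt hx).pow 2).add ((h.smooth_z.hasDerivWithinAt hx).pow 2)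
  have h2 : HasDerivWithinAt (ρ ^ 2 + z ^ 2) 0 (Icc a b) x :=
    (hasDerivWithinAt_const x (Icc a b) (1 : ℝ)).congr h.sq_add_sq (h.sq_add_sq x hx)
  have := (h1.der_eq hab hx).symm.trans (h2.der_eq hab hx)
  norm_num at this
  linarith

/-- The derivative of the third frame vector `ρ e - z A`. -/
theorem deriv_B (hab : a < b) (h : IsCylindrical a b T e A ρ z k) {x : ℝ} (hx : x ∈ Icc a b) :
    HasDerivWithinAt (fun x => ρ x • e - z x • A x)
      ((der a b ρ x * z x - der a b z x * ρ x) • T x - (z x * k x) • cross e (A x))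
      (Icc a b) x := by
  have h1 := ((h.smooth_ρ.hasDerivWithinAt hx).smul_const e).sub
    ((h.smooth_z.hasDerivWithinAt hx).smul (h.deriv_A x hx))
  refine h1.congr_deriv ?_
  have h2 := h.deriv_ρ hab hx
  have h3 := h.sq_add_sq x hx
  rw [h.eq x hx]
  linear_combination (norm := module) (der a b z x * h3 - z x * h2) • A x +
    (ρ x * h2 - der a b ρ x * h3) • e

theorem smooth_n (h : IsCylindrical a b T e A ρ z k) : SmoothOn a b (fun x => cross e (A x)) :=
  contDiffOn_const.cross h.smooth_A

theorem smooth_B (h : IsCylindrical a b T e A ρ z k) :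
    SmoothOn a b (fun x => ρ x • e - z x • A x) :=
  (h.smooth_ρ.smul contDiffOn_const).sub (h.smooth_z.smul h.smooth_A)

/-- The vectors e × A and ρe - zA form an orthonormal frame of the plane normal to T = ρA + ze; the
second one is T turned by a right angle in the plane of e and A. -/
theorem expansion (h : IsCylindrical a b T e A ρ z k) {x : ℝ} (hx : x ∈ Icc a b) {v : E3}
    (hv : inner ℝ v (T x) = 0) :
    v = inner ℝ v (cross e (A x)) • cross e (A x) +
      inner ℝ v (ρ x • e - z x • A x) • (ρ x • e - z x • A x) := by
  have h1 := orthonormal_expansion h.axis (h.unit x hx) (h.horizontal x hx) v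
  have h3 := h.sq_add_sq x hx
  rw [h.eq x hx, inner_add_right, inner_smul_right, inner_smul_right] at hv
  rw [inner_sub_right, inner_smul_right, inner_smul_right]
  set p := inner ℝ v e
  set q := inner ℝ v (A x)
  set w := inner ℝ v (cross e (A x))
  conv_lhs => rw [h1]
  linear_combination (norm := module) (z x * hv - p * h3) • e + (ρ x * hv - q * h3) • A x

variable {T₂ : ℝ → E3} {A₂ : ℝ → E3} {ρ₂ z₂ k₂ : ℝ → ℝ}

/-- In the frame e × A, ρe - zA of the normal plane a parallel field turns at the rate kz. Hence
parallel transport sees the curve only through the end frames and ∫kz. -/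
theorem hasHolonomy {γ₁ γ₂ : ℝ → E3} (hab : a < b)
    (h₁ : IsCylindrical a b (unitTangent a b γ₁) e A ρ z k)
    (h₂ : IsCylindrical a b (unitTangent a b γ₂) e A₂ ρ₂ z₂ k₂)
    (hAa : A a = A₂ a) (hAb : A b = A₂ b) (hza : z a = z₂ a) (hzb : z b = z₂ b)
    (hint : ∫ x in a..b, k x * z x = ∫ x in a..b, k₂ x * z₂ x)
    {Wa Wb : E3} {θ : Real.Angle} (hol : HasHolonomy a b γ₁ Wa Wb θ) :
    HasHolonomy a b γ₂ Wa Wb θ := by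
  have ha : a ∈ Icc a b := left_mem_Icc.2 hab.le
  have hb : b ∈ Icc a b := right_mem_Icc.2 hab.le
  have hρ : ∀ x ∈ Icc a b, z x = z₂ x → ρ x = ρ₂ x := fun x hx hz => by
    have e1 := h₁.sq_add_sq x hx
    have e2 := h₂.sq_add_sq x hx
    rw [hz] at e1
    have := h₁.pos x hx
    have := h₂.pos x hx
    nlinarith
  have hρa := hρ a ha hza
  have hρb := hρ b hb hzb
  have hTa : unitTangent a b γ₁ a = unitTangent a b γ₂ a := by
    rw [h₁.eq a ha, h₂.eq a ha, hρa, hza, hAa]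
  have hTb : unitTangent a b γ₁ b = unitTangent a b γ₂ b := by
    rw [h₁.eq b hb, h₂.eq b hb, hρb, hzb, hAb]
  obtain ⟨hWa, hWb, Z, ⟨hZs, hZn, l, hls, hl⟩, hZa, hZb⟩ := hol
  rw [hTa] at hWa
  rw [hTb] at hWb hZb
  refine ⟨hWa, hWb, ?_⟩
  set x : ℝ → ℝ := fun s => inner ℝ (Z s) (cross e (A s)) with hx
  set y : ℝ → ℝ := fun s => inner ℝ (Z s) (ρ s • e - z s • A s) with hy
  have hxs : SmoothOn a b x := ContDiffOn.inner ℝ hZs h₁.smooth_n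
  have hys : SmoothOn a b y := ContDiffOn.inner ℝ hZs h₁.smooth_B
  have hκs : SmoothOn a b (fun s => k s * z s - k₂ s * z₂ s) :=
    (h₁.smooth_k.mul h₁.smooth_z).sub (h₂.smooth_k.mul h₂.smooth_z)
  -- Turning the components of Z by ψ changes their rate from kz to k₂z₂, so that they become the
  -- components of a parallel field of the second curve. As ψ vanishes at both ends, the end values
  -- are unchanged.
  set ψ : ℝ → ℝ := fun s => ∫ u in a..s, (k u * z u - k₂ u * z₂ u) with hψ
  have hψs : SmoothOn a b ψ := hκs.smoothOn_primitive hab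
  have hψa : ψ a = 0 := by simp [hψ]
  have hψb : ψ b = 0 := by
    simp only [hψ]
    rw [intervalIntegral.integral_sub, hint, sub_self]
    · exact SmoothOn.intervalIntegrable hab (h₁.smooth_k.mul h₁.smooth_z)
    · exact SmoothOn.intervalIntegrable hab (h₂.smooth_k.mul h₂.smooth_z)
  have hx' : ∀ s ∈ Icc a b, HasDerivWithinAt x (k s * z s * y s) (Icc a b) s := fun s hs => by
    have h := (hZs.hasDerivWithinAt hs).inner ℝ (h₁.deriv_n hs)
    refine h.congr_deriv ?_
    have hn := hZn s hs
    have hsq := h₁.sq_add_sq s hs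
    rw [hl s hs]
    simp only [hy, h₁.eq s hs, inner_add_right, inner_sub_right, inner_add_left, inner_smul_left,
      inner_smul_right, inner_cross_self_left, inner_cross_self_right] at hn ⊢
    simp only [conj_trivial]
    linear_combination (-k s * ρ s) * hn + k s * inner ℝ (Z s) (A s) * hsq
  have hy' : ∀ s ∈ Icc a b, HasDerivWithinAt y (-(k s * z s * x s)) (Icc a b) s := fun s hs => by
    have h := (hZs.hasDerivWithinAt hs).inner ℝ (h₁.deriv_B hab hs)
    refine h.congr_deriv ?_
    have hn := hZn s hs
    have hA := h₁.unit s hs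
    have hAe := h₁.horizontal s hs
    have heA : inner ℝ e (A s) = 0 := by rw [real_inner_comm]; exact hAe
    have he := h₁.axis
    rw [hl s hs, inner_sub_right, inner_smul_right, hn]
    simp only [hx, h₁.eq s hs, inner_sub_right, inner_add_left, inner_smul_left,
      inner_smul_right, conj_trivial, hA, hAe, heA, he]
    ring
  set X : ℝ → ℝ := fun s => x s * Real.cos (ψ s) - y s * Real.sin (ψ s) with hX
  set Y : ℝ → ℝ := fun s => x s * Real.sin (ψ s) + y s * Real.cos (ψ s) with hY
  have hcs : SmoothOn a b (fun s => Real.cos (ψ s)) := Real.contDiff_cos.comp_contDiffOn hψs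
  have hss : SmoothOn a b (fun s => Real.sin (ψ s)) := Real.contDiff_sin.comp_contDiffOn hψs
  have hXs : SmoothOn a b X := (hxs.mul hcs).sub (hys.mul hss)
  have hYs : SmoothOn a b Y := (hxs.mul hss).add (hys.mul hcs)
  have hX' : ∀ s ∈ Icc a b, HasDerivWithinAt X (k₂ s * z₂ s * Y s) (Icc a b) s := fun s hs => by
    have hp := hκs.hasDerivWithinAt_primitive hs
    refine (((hx' s hs).mul hp.cos).sub ((hy' s hs).mul hp.sin)).congr_deriv ?_
    simp only [hY, hψ]
    ring
  have hY' : ∀ s ∈ Icc a b, HasDerivWithinAt Y (-(k₂ s * z₂ s * X s)) (Icc a b) s :=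
      fun s hs => by
    have hp := hκs.hasDerivWithinAt_primitive hs
    refine (((hx' s hs).mul hp.sin).add ((hy' s hs).mul hp.cos)).congr_deriv ?_
    simp only [hX, hψ]
    ring
  refine ⟨fun s => X s • cross e (A₂ s) + Y s • (ρ₂ s • e - z₂ s • A₂ s), ⟨?_, ?_, ?_⟩, ?_, ?_⟩
  · exact (hXs.smul h₂.smooth_n).add (hYs.smul h₂.smooth_B)
  · intro s hs
    have hA := h₂.unit s hs
    have hAe := h₂.horizontal s hs
    have heA : inner ℝ e (A₂ s) = 0 := by rw [real_inner_comm]; exact hAe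
    have he := h₂.axis
    have hn1 : inner ℝ (cross e (A₂ s)) e = 0 := by rw [real_inner_comm]; simp
    have hn2 : inner ℝ (cross e (A₂ s)) (A₂ s) = 0 := by rw [real_inner_comm]; simp
    simp only [h₂.eq s hs, inner_add_right, inner_sub_left, inner_add_left, inner_smul_left,
      inner_smul_right, conj_trivial, hA, hAe, heA, he, hn1, hn2]
    ring
  · refine ⟨fun s => Y s * (der a b ρ₂ s * z₂ s - der a b z₂ s * ρ₂ s) - k₂ s * ρ₂ s * X s,
      ?_, fun s hs => ?_⟩
    · exact (hYs.mul (((h₂.smooth_ρ.smoothOn_der hab).mul h₂.smooth_z).sub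
        ((h₂.smooth_z.smoothOn_der hab).mul h₂.smooth_ρ))).sub
        ((h₂.smooth_k.mul h₂.smooth_ρ).mul hXs)
    · refine HasDerivWithinAt.der_eq hab ?_ hs
      refine (((hX' s hs).smul (h₂.deriv_n hs)).add
        ((hY' s hs).smul (h₂.deriv_B hab hs))).congr_deriv ?_
      have hsq := h₂.sq_add_sq s hs
      rw [h₂.eq s hs]
      linear_combination (norm := module) (X s * k₂ s * hsq) • A₂ s
  · have := h₁.expansion ha (hZn a ha)
    rw [← hZa, this]
    simp only [hX, hY, hψa, Real.cos_zero, Real.sin_zero, mul_one, mul_zero, sub_zero, zero_add,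
      ← hAa, ← hρa, ← hza]
    rfl
  · have := h₁.expansion hb (hZn b hb)
    rw [← hZb, this]
    simp only [hX, hY, hψb, Real.cos_zero, Real.sin_zero, mul_one, mul_zero, sub_zero, zero_add,
      ← hAb, ← hρb, ← hzb]
    rfl

end IsCylindrical

end Cylindrical

/-! ### First variation of the bending energy. -/

section FirstVariation

open MeasureTheory Topology

variable {a b : ℝ} {γ : ℝ → E3} {ϱ : ℝ → ℝ}

theorem unitTangent_eq_der {x : ℝ} (h : ‖der a b γ x‖ = 1) : unitTangent a b γ x = der a b γ x := by
  simp [unitTangent, arcDer, h]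

theorem bendingEnergy_eq_of_isArcLength (hab : a < b) (harc : IsArcLength a b γ) :
    bendingEnergy a b ϱ γ = (1 / 2) * ∫ x in a..b,
      ϱ x * inner ℝ (der a b (der a b γ) x) (der a b (der a b γ) x) := by
  unfold bendingEnergy
  congr 1
  refine intervalIntegral.integral_congr fun x hx => ?_
  rw [uIcc_of_le hab.le] at hx
  have h1 : der a b (unitTangent a b γ) x = der a b (der a b γ) x :=
    der_congr (fun y hy => unitTangent_eq_der (harc y hy)) hx
  simp [arcDer, harc x hx, h1]

/-- If the unit tangent of a holonomy constrained elastic curve is varied by `D t`, with fixed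
integral and holonomy, then the field `∂D/∂t` is orthogonal to `(ϱ T')'`. -/
theorem IsHolonomyConstrainedElastic.integral_inner_eq_zero (hab : a < b)
    (hγ : IsCurve a b γ) (hϱ : IsStiffness a b ϱ) (harc : IsArcLength a b γ)
    (hel : IsHolonomyConstrainedElastic a b ϱ γ) {ε : ℝ} (hε : 0 < ε) {D : ℝ → ℝ → E3}
    (hD : ContDiffOn ℝ ∞ (fun q : ℝ × ℝ => D q.1 q.2) (Ioo (-ε) ε ×ˢ univ))
    (hD0 : ∀ x, D 0 x = 0) {δ : ℝ} (hδ : 0 < δ)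
    (hsupp : ∀ t ∈ Ioo (-ε) ε, ∀ x, x ∉ Icc (a + δ) (b - δ) → D t x = 0)
    (hnorm : ∀ t ∈ Ioo (-ε) ε, ∀ x ∈ Icc a b, ‖der a b γ x + D t x‖ = 1)
    (hint : ∀ t ∈ Ioo (-ε) ε, ∫ x in a..b, D t x = 0)
    (hhol : ∀ t ∈ Ioo (-ε) ε, ∀ γ' : ℝ → E3, SmoothOn a b γ' →
      (∀ x ∈ Icc a b, der a b γ' x = der a b γ x + D t x) →
      ∀ Wa Wb θ, HasHolonomy a b γ' Wa Wb θ ↔ HasHolonomy a b γ Wa Wb θ)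
    {V : ℝ → E3} (hV : ∀ x, HasDerivAt (fun t => D t x) (V x) 0) :
    ∫ x in a..b, inner ℝ (V x) (der a b (fun y => ϱ y • der a b (der a b γ) y) x) = 0 := by
  have h0 : (0 : ℝ) ∈ Ioo (-ε) ε := ⟨by linarith, hε⟩
  have hTs : SmoothOn a b (der a b γ) := hγ.smooth.smoothOn_der hab
  have hT's : SmoothOn a b (der a b (der a b γ)) := hTs.smoothOn_der hab
  have hso : IsOpen (Ioo (-ε) ε ×ˢ (univ : Set ℝ)) := isOpen_Ioo.prod isOpen_univ
  set Dx : ℝ → ℝ → E3 := fun t x => fderiv ℝ (fun q : ℝ × ℝ => D q.1 q.2) (t, x) (0, 1) with hDx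
  have hDxs : ContDiffOn ℝ ∞ (fun q : ℝ × ℝ => Dx q.1 q.2) (Ioo (-ε) ε ×ˢ univ) :=
    (hD.fderiv_of_isOpen hso (by simp)).clm_apply contDiffOn_const
  have hDder : ∀ t ∈ Ioo (-ε) ε, ∀ x, HasDerivAt (fun y => D t y) (Dx t x) x := fun t ht x =>
    HasFDerivAt.comp_hasDerivAt x
      ((hD.contDiffAt (hso.mem_nhds ⟨ht, mem_univ x⟩)).differentiableAt (by simp)).hasFDerivAt
      ((hasDerivAt_const x t).prodMk (hasDerivAt_id x))
  have hDsl : ∀ t ∈ Ioo (-ε) ε, ContDiff ℝ ∞ (D t) := fun t ht =>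
    contDiffOn_univ.1 (hD.comp (f := fun x => (t, x)) (by fun_prop) fun x _ => ⟨ht, mem_univ _⟩)
  have hDxsl : ∀ t ∈ Ioo (-ε) ε, ContDiff ℝ ∞ (Dx t) := fun t ht =>
    contDiffOn_univ.1 (hDxs.comp (f := fun x => (t, x)) (by fun_prop) fun x _ => ⟨ht, mem_univ _⟩)
  have hDx0 : ∀ x, Dx 0 x = 0 := fun x => by
    have := hDder 0 h0 x
    simp only [hD0] at this
    exact this.unique (hasDerivAt_const x 0)
  have hDxsupp : ∀ t ∈ Ioo (-ε) ε, ∀ x, x ∉ Icc (a + δ) (b - δ) → Dx t x = 0 := fun t ht x hx => by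
    refine (hDder t ht x).unique ((hasDerivAt_const x (0 : E3)).congr_of_eventuallyEq ?_)
    filter_upwards [isClosed_Icc.isOpen_compl.mem_nhds hx] with y hy
    exact hsupp t ht y hy
  -- The curve is rebuilt from its tangent. The support of D together with ∫D = 0 makes it agree
  -- with γ near both ends.
  set Γ : ℝ → ℝ → E3 := fun t x => γ x + ∫ y in a..x, D t y with hΓ
  have hΓder : ∀ t ∈ Ioo (-ε) ε, ∀ x ∈ Icc a b,
      HasDerivWithinAt (Γ t) (der a b γ x + D t x) (Icc a b) x := fun t ht x hx =>
    (hγ.smooth.hasDerivWithinAt hx).add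
      ((hDsl t ht).continuous.integral_hasStrictDerivAt a x).hasDerivAt.hasDerivWithinAt
  have hΓd : ∀ t ∈ Ioo (-ε) ε, ∀ x ∈ Icc a b, der a b (Γ t) x = der a b γ x + D t x :=
    fun t ht x hx => (hΓder t ht x hx).der_eq hab hx
  -- A compact variation is smooth over a closed parameter interval, while D is given over an open
  -- one; hence ε / 2.
  have hsub : Icc (-(ε / 2)) (ε / 2) ⊆ Ioo (-ε) ε := fun t ht =>
    ⟨by linarith [ht.1], by linarith [ht.2]⟩
  have hvar : IsCompactVariation a b γ (ε / 2) Γ := by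
    refine ⟨?_, fun x _ => by simp [hΓ, hD0], δ / 2, by positivity, fun t ht x hx hx' => ?_⟩
    · refine ContDiffOn.add ?_ ?_
      · exact hγ.smooth.comp contDiff_snd.contDiffOn fun q hq => hq.2
      · exact (contDiffOn_primitive_param isOpen_Ioo hD a).mono (prod_mono hsub (subset_univ _))
    · have ht' := hsub ht
      simp only [hΓ, add_eq_left]
      have hzero : ∀ c d : ℝ, c ≤ d → (∀ y ∈ Icc c d, y ∉ Icc (a + δ) (b - δ)) →
          ∫ y in c..d, D t y = 0 := fun c d hcd h => by
        rw [intervalIntegral.integral_congr (g := fun _ => (0 : E3))]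
        · simp
        · intro y hy
          rw [uIcc_of_le hcd] at hy
          exact hsupp t ht' y (h y hy)
      rcases hx' with hx' | hx'
      · exact hzero a x hx.1 fun y hy hy' => by linarith [hy.2, hy'.1]
      · have h1 := hzero x b hx.2 fun y hy hy' => by linarith [hy.1, hy'.2]
        have h2 := intervalIntegral.integral_add_adjacent_intervals
          ((hDsl t ht').continuous.intervalIntegrable (μ := volume) a x)
          ((hDsl t ht').continuous.intervalIntegrable (μ := volume) x b)
        rwa [h1, add_zero, hint t ht'] at h2
  have hΓarc : ∀ t ∈ Ioo (-ε) ε, IsArcLength a b (Γ t) := fun t ht x hx => by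
    rw [hΓd t ht x hx, hnorm t ht x hx]
  have hΓs : ∀ t ∈ Ioo (-ε) ε, SmoothOn a b (Γ t) := fun t ht =>
    SmoothOn.of_hasDerivWithinAt hab (hTs.add (hDsl t ht).contDiffOn) (hΓder t ht)
  have hE := hel (ε / 2) Γ (by positivity) hvar
    (fun t ht x hx => by rw [hΓarc t (hsub ht) x hx, harc x hx])
    (fun t ht Wa Wb θ => hhol t (hsub ht) _ (hΓs t (hsub ht)) (hΓd t (hsub ht)) Wa Wb θ)
  set P : ℝ → E3 := fun y => ϱ y • der a b (der a b γ) y with hP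
  have hPs : SmoothOn a b P := hϱ.smooth.smul hT's
  have hP's : SmoothOn a b (der a b P) := hPs.smoothOn_der hab
  -- This is the change of the energy density, with the cross term ⟨D_x, P⟩ replaced by -⟨D, P'⟩
  -- through integration by parts. The other term is quadratic in D_x, which vanishes at t = 0, and
  -- contributes nothing to the derivative.
  set G : ℝ → ℝ → ℝ := fun t x =>
    -inner ℝ (D t x) (der a b P x) + 1 / 2 * (ϱ x * inner ℝ (Dx t x) (Dx t x)) with hG
  have hGs : ContDiffOn ℝ ∞ (fun q : ℝ × ℝ => G q.1 q.2) (Ioo (-ε) ε ×ˢ univ) := by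
    refine contDiffOn_prod_univ_of_eq_zero isOpen_Ioo (U := Ioo a b) (K := Icc (a + δ) (b - δ))
      isOpen_Ioo isClosed_Icc (fun x hx => ⟨by linarith [hx.1], by linarith [hx.2]⟩) ?_
      (fun t ht x hx => by simp [hG, hsupp t ht x hx, hDxsupp t ht x hx])
    have hm : Ioo (-ε) ε ×ˢ Ioo a b ⊆ Ioo (-ε) ε ×ˢ univ := prod_mono le_rfl (subset_univ _)
    have hmaps : MapsTo Prod.snd (Ioo (-ε) ε ×ˢ Ioo a b) (Icc a b) :=
      fun q hq => Ioo_subset_Icc_self hq.2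
    refine ContDiffOn.add (ContDiffOn.neg ?_) (contDiffOn_const.mul (ContDiffOn.mul ?_ ?_))
    · exact ContDiffOn.inner ℝ (hD.mono hm) (hP's.comp contDiff_snd.contDiffOn hmaps)
    · exact hϱ.smooth.comp contDiff_snd.contDiffOn hmaps
    · exact ContDiffOn.inner ℝ (hDxs.mono hm) (hDxs.mono hm)
  have hGder : ∀ x, HasDerivAt (fun t => G t x) (-inner ℝ (V x) (der a b P x)) 0 := fun x => by
    have hW : DifferentiableAt ℝ (fun t => Dx t x) 0 := by
      have h1 : DifferentiableAt ℝ (fun q : ℝ × ℝ => Dx q.1 q.2) (0, x) :=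
        (hDxs.contDiffAt (hso.mem_nhds ⟨h0, mem_univ x⟩)).differentiableAt (by simp)
      exact h1.comp (0 : ℝ) (f := fun t : ℝ => (t, x)) (by fun_prop)
    have h1 := ((hV x).inner ℝ (hasDerivAt_const 0 (der a b P x))).neg.add
      (((hW.hasDerivAt.inner ℝ hW.hasDerivAt).const_mul (ϱ x)).const_mul (1 / 2))
    refine h1.congr_deriv ?_
    simp [hDx0]
  have hEG : ∀ t ∈ Ioo (-ε) ε,
      bendingEnergy a b ϱ (Γ t) = bendingEnergy a b ϱ γ + ∫ x in a..b, G t x := fun t ht => by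
    rw [bendingEnergy_eq_of_isArcLength hab (hΓarc t ht),
      bendingEnergy_eq_of_isArcLength hab harc]
    have hDDs : SmoothOn a b (D t) := (hDsl t ht).contDiffOn
    have hDxxs : SmoothOn a b (Dx t) := (hDxsl t ht).contDiffOn
    have hT2 : ∀ x ∈ Icc a b, der a b (der a b (Γ t)) x = der a b (der a b γ) x + Dx t x :=
      fun x hx => by
        rw [der_congr (hΓd t ht) hx]
        exact HasDerivWithinAt.der_eq hab
          ((hTs.hasDerivWithinAt hx).add (hDder t ht x).hasDerivWithinAt) hx
    have hparts : ∫ x in a..b, (inner ℝ (Dx t x) (P x) + inner ℝ (D t x) (der a b P x)) = 0 := by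
      have hs : SmoothOn a b (fun x => inner ℝ (D t x) (P x)) := ContDiffOn.inner ℝ hDDs hPs
      have h1 := hs.integral_der hab
      rw [hsupp t ht a (fun h => by linarith [h.1]), hsupp t ht b (fun h => by linarith [h.2]),
        inner_zero_left, inner_zero_left, sub_zero] at h1
      rw [← h1]
      refine intervalIntegral.integral_congr fun x hx => ?_
      rw [uIcc_of_le hab.le] at hx
      have := ((hDder t ht x).hasDerivWithinAt (s := Icc a b)).inner ℝ (hPs.hasDerivWithinAt hx)
      rw [this.der_eq hab hx, add_comm]
    have i1 : IntervalIntegrable (fun x => ϱ x * inner ℝ (der a b (der a b γ) x)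
        (der a b (der a b γ) x)) volume a b :=
      SmoothOn.intervalIntegrable hab (hϱ.smooth.mul (ContDiffOn.inner ℝ hT's hT's))
    have i2 : IntervalIntegrable
        (fun x => inner ℝ (Dx t x) (P x) + inner ℝ (D t x) (der a b P x)) volume a b :=
      SmoothOn.intervalIntegrable hab
        ((ContDiffOn.inner ℝ hDxxs hPs).add (ContDiffOn.inner ℝ hDDs hP's))
    have i3 : IntervalIntegrable (G t) volume a b :=
      (continuousOn_univ.1 (hGs.continuousOn.comp (f := fun x => (t, x)) (by fun_prop)
        fun x _ => ⟨ht, mem_univ _⟩)).intervalIntegrable a b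
    rw [← intervalIntegral.integral_const_mul, ← intervalIntegral.integral_const_mul,
      ← add_zero (∫ x in a..b, G t x), ← hparts,
      ← intervalIntegral.integral_add i3 i2,
      ← intervalIntegral.integral_add (i1.const_mul _) (i3.add i2)]
    refine intervalIntegral.integral_congr fun x hx => ?_
    rw [uIcc_of_le hab.le] at hx
    rw [hT2 x hx]
    simp only [hG, hP, inner_add_left, inner_add_right, inner_smul_right]
    rw [real_inner_comm (Dx t x) (der a b (der a b γ) x)]
    ring
  have hE2 : HasDerivAt (fun t => bendingEnergy a b ϱ (Γ t))
      (∫ x in a..b, -inner ℝ (V x) (der a b P x)) 0 := by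
    have h1 := (hasDerivAt_intervalIntegral_param isOpen_Ioo h0 hGs (a := a) (b := b) hGder
      ).const_add (bendingEnergy a b ϱ γ)
    refine h1.congr_of_eventuallyEq ?_
    filter_upwards [isOpen_Ioo.mem_nhds h0] with t ht using hEG t ht
  have := hE2.unique hE
  rwa [intervalIntegral.integral_neg, neg_eq_zero] at this

end FirstVariation

/-! ### Turning and raising the tangent. -/

section CylindricalVariation

open MeasureTheory Topology

variable {a b : ℝ}

namespace testSpace

variable {F : Type*} [NormedAddCommGroup F] [NormedSpace ℝ F] {U : ℝ → F}

theorem eq_zero (hU : U ∈ testSpace a b F) {x : ℝ} (hx : x ∉ Ioo a b) : U x = 0 :=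
  image_eq_zero_of_notMem_tsupport fun h => hx (hU.2 h)

theorem smoothOn (hU : U ∈ testSpace a b F) : SmoothOn a b U := hU.1.contDiffOn

theorem deriv_mem (hU : U ∈ testSpace a b F) : deriv U ∈ testSpace a b F :=
  ⟨(contDiff_infty_iff_deriv.1 hU.1).2, (tsupport_deriv_subset).trans hU.2⟩

theorem hasDerivAt (hU : U ∈ testSpace a b F) (x : ℝ) : HasDerivAt U (deriv U x) x :=
  (hU.1.differentiable (by simp) x).hasDerivAt

end testSpace

/-- Integration by parts against a test function. -/
theorem integral_deriv_mul_test (hab : a < b) {f α : ℝ → ℝ} (hf : SmoothOn a b f)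
    (hα : α ∈ testSpace a b ℝ) :
    ∫ x in a..b, f x * deriv α x = -∫ x in a..b, der a b f x * α x := by
  have hs : SmoothOn a b (fun x => f x * α x) := hf.mul (testSpace.smoothOn hα)
  have h1 := hs.integral_der hab
  rw [testSpace.eq_zero hα (x := a) (by simp), testSpace.eq_zero hα (x := b) (by simp)] at h1
  have h2 : ∫ x in a..b, der a b (fun x => f x * α x) x =
      ∫ x in a..b, (der a b f x * α x + f x * deriv α x) := by
    refine intervalIntegral.integral_congr fun x hx => ?_
    rw [uIcc_of_le hab.le] at hx
    exact ((hf.hasDerivWithinAt hx).mul (testSpace.hasDerivAt hα x).hasDerivWithinAt).der_eq hab hx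
  rw [h2, intervalIntegral.integral_add] at h1
  · linarith
  · exact SmoothOn.intervalIntegrable hab ((hf.smoothOn_der hab).mul (testSpace.smoothOn hα))
  · exact SmoothOn.intervalIntegrable hab (hf.mul (testSpace.smoothOn (testSpace.deriv_mem hα)))

theorem exists_Icc_of_isCompact {K : Set ℝ} (hK : IsCompact K) (hKs : K ⊆ Ioo a b) :
    ∃ δ > 0, K ⊆ Icc (a + δ) (b - δ) := by
  rcases K.eq_empty_or_nonempty with rfl | hne
  · exact ⟨1, one_pos, empty_subset _⟩
  obtain ⟨l, hl, hlK⟩ := hK.exists_isLeast hne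
  obtain ⟨u, hu, huK⟩ := hK.exists_isGreatest hne
  have h1 := (hKs hl).1
  have h2 := (hKs hu).2
  refine ⟨min (l - a) (b - u), lt_min (by linarith) (by linarith), fun x hx => ⟨?_, ?_⟩⟩
  · linarith [hlK hx, min_le_left (l - a) (b - u)]
  · linarith [huK hx, min_le_right (l - a) (b - u)]

/-- The change of `√(1 - z²) A + z e` under a turn by `α` about `e` and a raise of `z` by `β`. -/
noncomputable def cylDisp (e A : E3) (z α β : ℝ) : E3 :=
  (√(1 - (z + β) ^ 2) * Real.cos α - √(1 - z ^ 2)) • A +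
    (√(1 - (z + β) ^ 2) * Real.sin α) • cross e A + β • e

/-- The first order part of `cylDisp`. -/
noncomputable def cylField (e A : E3) (ρ z α β : ℝ) : E3 :=
  (α * ρ) • cross e A + β • (e - (z / ρ) • A)

@[simp] theorem cylDisp_zero (e A : E3) (z : ℝ) : cylDisp e A z 0 0 = 0 := by
  simp [cylDisp]

@[simp] theorem cylField_zero (e A : E3) (ρ z : ℝ) : cylField e A ρ z 0 0 = 0 := by
  simp [cylField]

/-- The root is differentiable because 1 - z² = ρ² > 0. Its derivative -(z / ρ)β' is the horizontal
correction that keeps the tangent on the sphere to first order. -/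
theorem hasDerivAt_cylDisp {e A : E3} {ρ z : ℝ} (hρ : 0 < ρ) (hz : ρ ^ 2 + z ^ 2 = 1)
    {α β : ℝ → ℝ} {α' β' : ℝ} (hα : HasDerivAt α α' 0) (hβ : HasDerivAt β β' 0)
    (hα0 : α 0 = 0) (hβ0 : β 0 = 0) :
    HasDerivAt (fun t => cylDisp e A z (α t) (β t)) (cylField e A ρ z α' β') 0 := by
  have h1z : 1 - z ^ 2 = ρ ^ 2 := by linarith
  have hs : HasDerivAt (fun t => √(1 - (z + β t) ^ 2)) (-(z / ρ) * β') 0 := by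
    have h := (((hβ.const_add z).pow 2).const_sub 1).sqrt (by
      simp only [Pi.pow_apply, hβ0, add_zero, h1z]; positivity)
    refine h.congr_deriv ?_
    simp only [Pi.pow_apply, hβ0, add_zero, h1z, Real.sqrt_sq hρ.le]
    field_simp
    norm_num
    ring
  have h := (((hs.mul hα.cos).sub_const (√(1 - z ^ 2))).smul_const A).add
    ((hs.mul hα.sin).smul_const (cross e A)) |>.add (hβ.smul_const e)
  refine h.congr_deriv ?_
  simp only [hα0, hβ0, add_zero, h1z, Real.sqrt_sq hρ.le, Real.cos_zero, Real.sin_zero, cylField]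
  module

namespace IsCylindrical

variable {T : ℝ → E3} {e : E3} {A : ℝ → E3} {ρ z k : ℝ → ℝ}

theorem congr (h : IsCylindrical a b T e A ρ z k) {T' : ℝ → E3} (hT : ∀ x ∈ Icc a b, T' x = T x) :
    IsCylindrical a b T' e A ρ z k :=
  { h with eq := fun x hx => (hT x hx).trans (h.eq x hx) }

theorem norm_eq_one (h : IsCylindrical a b T e A ρ z k) {x : ℝ} (hx : x ∈ Icc a b) :
    ‖T x‖ = 1 := by
  have h1 := h.horizontal x hx
  have h2 : inner ℝ e (A x) = 0 := by rw [real_inner_comm]; exact h1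
  have : inner ℝ (T x) (T x) = 1 := by
    simp only [h.eq x hx, inner_add_left, inner_add_right, inner_smul_left, inner_smul_right,
      conj_trivial, h.unit x hx, h.axis, h1, h2]
    linear_combination h.sq_add_sq x hx
  rw [real_inner_self_eq_norm_sq] at this
  nlinarith [norm_nonneg (T x)]

theorem sqrt_eq (h : IsCylindrical a b T e A ρ z k) {x : ℝ} (hx : x ∈ Icc a b) :
    √(1 - z x ^ 2) = ρ x := by
  rw [show 1 - z x ^ 2 = ρ x ^ 2 by linarith [h.sq_add_sq x hx], Real.sqrt_sq (h.pos x hx).le]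

/-- Turning by `α` and raising by `β` keeps cylindrical coordinates. -/
theorem varied (h : IsCylindrical a b T e A ρ z k) {α β : ℝ → ℝ} (hα : ContDiff ℝ ∞ α)
    (hβ : ContDiff ℝ ∞ β) (hlt : ∀ x ∈ Icc a b, (z x + β x) ^ 2 < 1) :
    IsCylindrical a b (fun x => T x + cylDisp e (A x) (z x) (α x) (β x)) e
      (fun x => Real.cos (α x) • A x + Real.sin (α x) • cross e (A x))
      (fun x => √(1 - (z x + β x) ^ 2)) (fun x => z x + β x) (fun x => k x + deriv α x) := by
  have hzs : SmoothOn a b (fun x => z x + β x) := h.smooth_z.add hβ.contDiffOn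
  have hpos : ∀ x ∈ Icc a b, 0 < 1 - (z x + β x) ^ 2 := fun x hx => by linarith [hlt x hx]
  have hα' : ContDiff ℝ ∞ (deriv α) := (contDiff_infty_iff_deriv.1 hα).2
  refine ⟨h.axis, ?_, ?_, hzs, h.smooth_k.add hα'.contDiffOn, ?_, ?_,
    fun x hx => Real.sqrt_pos.2 (hpos x hx), ?_, ?_, ?_⟩
  · exact ((Real.contDiff_cos.comp hα).contDiffOn.smul h.smooth_A).add
      ((Real.contDiff_sin.comp hα).contDiffOn.smul h.smooth_n)
  · exact ContDiffOn.sqrt (contDiffOn_const.sub (hzs.pow 2)) fun x hx => (hpos x hx).ne'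
  · intro x hx
    have h2 : inner ℝ (cross e (A x)) (A x) = 0 := by rw [real_inner_comm]; simp
    have h3 : inner ℝ e (A x) = 0 := by rw [real_inner_comm]; exact h.horizontal x hx
    simp only [inner_add_left, inner_add_right, inner_smul_left, inner_smul_right,
      conj_trivial, h.unit x hx, inner_cross_self_right, inner_cross_cross, h2, h.axis, h3]
    linear_combination Real.cos_sq_add_sin_sq (α x)
  · intro x hx
    have h2 : inner ℝ (cross e (A x)) e = 0 := by rw [real_inner_comm]; simp
    simp [inner_add_left, inner_smul_left, h.horizontal x hx, h2]
  · intro x hx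
    rw [Real.sq_sqrt (hpos x hx).le]
    ring
  · intro x hx
    rw [h.eq x hx, cylDisp, h.sqrt_eq hx]
    module
  · intro x hx
    have hd : HasDerivWithinAt α (deriv α x) (Icc a b) x :=
      (hα.differentiable (by simp) x).hasDerivAt.hasDerivWithinAt
    have h1 := (hd.cos.smul (h.deriv_A x hx)).add (hd.sin.smul (h.deriv_n hx))
    refine h1.congr_deriv ?_
    have h3 : inner ℝ e (A x) = 0 := by rw [real_inner_comm]; exact h.horizontal x hx
    rw [cross_add_right, cross_smul_right, cross_smul_right, cross_cross_left, h3, h.axis]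
    module

end IsCylindrical

end CylindricalVariation

/-! ### Finite-dimensional families and exact solution of the constraints. -/

section FamilyOfVariations

open MeasureTheory Topology

variable {a b : ℝ} {ι : Type*} [Fintype ι]

/-- The combination `p.1 f₀ + ∑ j, p.2 j f j`. -/
def comb (f₀ : ℝ → ℝ) (f : ι → ℝ → ℝ) (p : ℝ × (ι → ℝ)) (x : ℝ) : ℝ :=
  p.1 * f₀ x + ∑ j, p.2 j * f j x

theorem comb_zero (f₀ : ℝ → ℝ) (f : ι → ℝ → ℝ) (x : ℝ) : comb f₀ f 0 x = 0 := by
  simp [comb]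

theorem comb_smul (f₀ : ℝ → ℝ) (f : ι → ℝ → ℝ) (c : ℝ) (p : ℝ × (ι → ℝ)) (x : ℝ) :
    comb f₀ f (c • p) x = c * comb f₀ f p x := by
  simp [comb, mul_add, Finset.mul_sum, mul_assoc]

theorem contDiff_comb {f₀ : ℝ → ℝ} {f : ι → ℝ → ℝ} (h₀ : ContDiff ℝ ∞ f₀)
    (h : ∀ j, ContDiff ℝ ∞ (f j)) :
    ContDiff ℝ ∞ (fun q : (ℝ × (ι → ℝ)) × ℝ => comb f₀ f q.1 q.2) := by
  refine (ContDiff.mul (by fun_prop) (h₀.comp contDiff_snd)).add (ContDiff.sum fun j _ => ?_)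
  exact ContDiff.mul (by fun_prop) ((h j).comp contDiff_snd)

theorem comb_mem {f₀ : ℝ → ℝ} {f : ι → ℝ → ℝ} (h₀ : f₀ ∈ testSpace a b ℝ)
    (h : ∀ j, f j ∈ testSpace a b ℝ) (p : ℝ × (ι → ℝ)) : comb f₀ f p ∈ testSpace a b ℝ := by
  have : comb f₀ f p = p.1 • f₀ + ∑ j, p.2 j • f j := by
    ext x; simp [comb]
  rw [this]
  exact Submodule.add_mem _ (Submodule.smul_mem _ _ h₀)
    (Submodule.sum_mem _ fun j _ => Submodule.smul_mem _ _ (h j))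

theorem deriv_comb {f₀ : ℝ → ℝ} {f : ι → ℝ → ℝ} (h₀ : f₀ ∈ testSpace a b ℝ)
    (h : ∀ j, f j ∈ testSpace a b ℝ) (p : ℝ × (ι → ℝ)) :
    deriv (comb f₀ f p) = comb (deriv f₀) (fun j => deriv (f j)) p := by
  ext x
  refine HasDerivAt.deriv (((testSpace.hasDerivAt h₀ x).const_mul _).add ?_)
  exact HasDerivAt.fun_sum fun j _ => (testSpace.hasDerivAt (h j) x).const_mul _

theorem integral_comb {f₀ : ℝ → ℝ} {f : ι → ℝ → ℝ} (h₀ : IntervalIntegrable f₀ volume a b)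
    (h : ∀ j, IntervalIntegrable (f j) volume a b) (p : ℝ × (ι → ℝ)) :
    ∫ x in a..b, comb f₀ f p x =
      p.1 * (∫ x in a..b, f₀ x) + ∑ j, p.2 j * ∫ x in a..b, f j x := by
  simp only [comb]
  rw [intervalIntegral.integral_add (h₀.const_mul _)
    (by simpa only [Finset.sum_fn] using
      IntervalIntegrable.sum Finset.univ fun j _ => (h j).const_mul (p.2 j)),
    intervalIntegral.integral_finsetSum fun j _ => (h j).const_mul _]
  simp

/-- The density of the change of holonomy under a turn by `α` and a raise by `β`. -/
noncomputable def cylHol (a b : ℝ) (z k α β : ℝ → ℝ) (x : ℝ) : ℝ :=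
  β x * k x - der a b z x * α x + β x * deriv α x

/-- A constraint density: a combination of a component of the displacement, of the holonomy and
of the rate of turning. -/
noncomputable def cylConstraint (a b : ℝ) (e : E3) (A : ℝ → E3) (z k : ℝ → ℝ) (c : E3) (y : ℝ)
    (m : ℝ → ℝ) (α β : ℝ → ℝ) (x : ℝ) : ℝ :=
  -- One shape serves both cases: closure and holonomy when the densities are independent,
  -- horizontal closure and ∫mα' when the tangent turns uniformly.
  inner ℝ c (cylDisp e (A x) (z x) (α x) (β x)) + y * cylHol a b z k α β x + m x * deriv α x

/-- The first order part of `cylConstraint`. -/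
noncomputable def cylConstraintLin (a b : ℝ) (e : E3) (A : ℝ → E3) (ρ z k : ℝ → ℝ) (c : E3) (y : ℝ)
    (m : ℝ → ℝ) (α β : ℝ → ℝ) (x : ℝ) : ℝ :=
  inner ℝ c (cylField e (A x) (ρ x) (z x) (α x) (β x)) +
    y * (β x * k x - der a b z x * α x) + m x * deriv α x

theorem cylConstraintLin_comb {e : E3} {A : ℝ → E3} {ρ z k : ℝ → ℝ} {c : E3} {y : ℝ} {m : ℝ → ℝ}
    {α₀ β₀ : ℝ → ℝ} {α β : ι → ℝ → ℝ} (hα₀ : α₀ ∈ testSpace a b ℝ)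
    (hα : ∀ j, α j ∈ testSpace a b ℝ) (p : ℝ × (ι → ℝ)) (x : ℝ) :
    cylConstraintLin a b e A ρ z k c y m (comb α₀ α p) (comb β₀ β p) x =
      comb (cylConstraintLin a b e A ρ z k c y m α₀ β₀)
        (fun j => cylConstraintLin a b e A ρ z k c y m (α j) (β j)) p x := by
  have key : ∀ α β : ℝ → ℝ, cylConstraintLin a b e A ρ z k c y m α β x =
      (ρ x * inner ℝ c (cross e (A x)) - y * der a b z x) * α x +
      (inner ℝ c (e - (z x / ρ x) • A x) + y * k x) * β x + m x * deriv α x := fun α β => by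
    simp only [cylConstraintLin, cylField, inner_add_right, inner_smul_right]
    ring
  simp only [comb, key, deriv_comb hα₀ hα, mul_add, Finset.sum_add_distrib, Finset.mul_sum]
  have : ∀ c d : ℝ, ∀ j, p.2 j * (c * d) = c * (p.2 j * d) := fun c d j => by ring
  simp only [this]
  ring

theorem IsCylindrical.smoothOn_cylConstraintLin (hab : a < b) {T : ℝ → E3} {e : E3} {A : ℝ → E3}
    {ρ z k : ℝ → ℝ} (C : IsCylindrical a b T e A ρ z k) (c : E3) (y : ℝ) {m : ℝ → ℝ}
    (hm : SmoothOn a b m) {α β : ℝ → ℝ} (hα : α ∈ testSpace a b ℝ) (hβ : β ∈ testSpace a b ℝ) :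
    SmoothOn a b (cylConstraintLin a b e A ρ z k c y m α β) := by
  have hαs := testSpace.smoothOn hα
  have hβs := testSpace.smoothOn hβ
  refine ContDiffOn.add (ContDiffOn.add (ContDiffOn.inner ℝ contDiffOn_const ?_)
    (contDiffOn_const.mul ?_)) (hm.mul (testSpace.smoothOn (testSpace.deriv_mem hα)))
  · exact ((hαs.mul C.smooth_ρ).smul C.smooth_n).add (hβs.smul (contDiffOn_const.sub
      ((C.smooth_z.div C.smooth_ρ fun x hx => (C.pos x hx).ne').smul C.smooth_A)))
  · exact (hβs.mul C.smooth_k).sub ((C.smooth_z.smoothOn_der hab).mul hαs)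

theorem IsCylindrical.hasHolonomy_varied_iff (hab : a < b) {γ γ' : ℝ → E3} {e : E3} {A : ℝ → E3}
    {ρ z k : ℝ → ℝ} (harc : IsArcLength a b γ) (C : IsCylindrical a b (der a b γ) e A ρ z k)
    {α β : ℝ → ℝ} (hα : α ∈ testSpace a b ℝ) (hβ : β ∈ testSpace a b ℝ)
    (hlt : ∀ x ∈ Icc a b, (z x + β x) ^ 2 < 1)
    (hγ' : ∀ x ∈ Icc a b, der a b γ' x = der a b γ x + cylDisp e (A x) (z x) (α x) (β x))
    (hhol : ∫ x in a..b, cylHol a b z k α β x = 0) (Wa Wb : E3) (θ : Real.Angle) :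
    HasHolonomy a b γ' Wa Wb θ ↔ HasHolonomy a b γ Wa Wb θ := by
  have C₂ := (C.varied hα.1 hβ.1 hlt).congr hγ'
  have h₁ := C.congr fun x hx => unitTangent_eq_der (harc x hx)
  have h₂ := C₂.congr fun x hx => unitTangent_eq_der (C₂.norm_eq_one hx)
  have hαa := testSpace.eq_zero hα (x := a) (by simp)
  have hαb := testSpace.eq_zero hα (x := b) (by simp)
  have hβa := testSpace.eq_zero hβ (x := a) (by simp)
  have hβb := testSpace.eq_zero hβ (x := b) (by simp)
  have hαs := testSpace.smoothOn hα
  have hβs := testSpace.smoothOn hβ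
  have hα's := testSpace.smoothOn (testSpace.deriv_mem hα)
  -- The difference (k + α')(z + β) - kz exceeds `cylHol` by zα' + z'α, which integrates to zero.
  have hint : ∫ x in a..b, k x * z x = ∫ x in a..b, (k x + deriv α x) * (z x + β x) := by
    have i1 := SmoothOn.intervalIntegrable hab (C.smooth_k.mul C.smooth_z)
    have i2 := SmoothOn.intervalIntegrable hab (C.smooth_z.mul hα's)
    have i3 := SmoothOn.intervalIntegrable hab ((C.smooth_z.smoothOn_der hab).mul hαs)
    have i4 : IntervalIntegrable (cylHol a b z k α β) volume a b :=
      SmoothOn.intervalIntegrable hab (((hβs.mul C.smooth_k).sub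
        ((C.smooth_z.smoothOn_der hab).mul hαs)).add (hβs.mul hα's))
    have hp := integral_deriv_mul_test hab C.smooth_z hα
    calc ∫ x in a..b, k x * z x
        = (∫ x in a..b, k x * z x) + (∫ x in a..b, cylHol a b z k α β x) +
          (∫ x in a..b, z x * deriv α x) + ∫ x in a..b, der a b z x * α x := by
          rw [hhol, hp]; ring
      _ = ∫ x in a..b, (k x + deriv α x) * (z x + β x) := by
          rw [← intervalIntegral.integral_add i1 i4,
            ← intervalIntegral.integral_add (i1.add i4) i2,
            ← intervalIntegral.integral_add ((i1.add i4).add i2) i3]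
          refine intervalIntegral.integral_congr fun x _ => ?_
          simp only [cylHol]
          ring
  constructor
  · exact h₂.hasHolonomy hab h₁ (by simp [hαa]) (by simp [hαb]) (by simp [hβa]) (by simp [hβb])
      hint.symm
  · exact h₁.hasHolonomy hab h₂ (by simp [hαa]) (by simp [hαb]) (by simp [hβa]) (by simp [hβb])
      hint

/-- The first variation in a direction `(α₀, β₀)` for which the constraints can be solved with
correctors `(α j, β j)` dual to the linearized constraints. -/
theorem IsHolonomyConstrainedElastic.integral_inner_cylField_eq_zero [DecidableEq ι] (hab : a < b)
    {γ : ℝ → E3} {ϱ : ℝ → ℝ}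
    (hγ : IsCurve a b γ) (hϱ : IsStiffness a b ϱ) (harc : IsArcLength a b γ)
    (hel : IsHolonomyConstrainedElastic a b ϱ γ) {e : E3} {A : ℝ → E3} {ρ z k : ℝ → ℝ}
    (C : IsCylindrical a b (der a b γ) e A ρ z k)
    {α₀ β₀ : ℝ → ℝ} {α β : ι → ℝ → ℝ}
    (hα₀ : α₀ ∈ testSpace a b ℝ) (hβ₀ : β₀ ∈ testSpace a b ℝ)
    (hα : ∀ j, α j ∈ testSpace a b ℝ) (hβ : ∀ j, β j ∈ testSpace a b ℝ)
    {c : ι → E3} {y : ι → ℝ} {m : ι → ℝ → ℝ} (hm : ∀ i, ContDiff ℝ ∞ (m i))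
    (hbase : ∀ i, ∫ x in a..b, cylConstraintLin a b e A ρ z k (c i) (y i) (m i) α₀ β₀ x = 0)
    (hdual : ∀ i j, ∫ x in a..b, cylConstraintLin a b e A ρ z k (c i) (y i) (m i) (α j) (β j) x =
      if i = j then 1 else 0)
    -- The scalar equations that are solved need not be the geometric constraints; it is enough that
    -- they imply them within this family.
    (hcon : ∀ p : ℝ × (ι → ℝ), (∀ i, ∫ x in a..b,
        cylConstraint a b e A z k (c i) (y i) (m i) (comb α₀ α p) (comb β₀ β p) x = 0) →
      (∫ x in a..b, cylDisp e (A x) (z x) (comb α₀ α p x) (comb β₀ β p x) = 0) ∧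
      ∫ x in a..b, cylHol a b z k (comb α₀ α p) (comb β₀ β p) x = 0) :
    ∫ x in a..b, inner ℝ (cylField e (A x) (ρ x) (z x) (α₀ x) (β₀ x))
      (der a b (fun y => ϱ y • der a b (der a b γ) y) x) = 0 := by
  classical
  -- a common support
  obtain ⟨δ, hδ, hKδ⟩ := exists_Icc_of_isCompact (a := a) (b := b)
    (K := (tsupport α₀ ∪ tsupport β₀) ∪ ⋃ j, (tsupport (α j) ∪ tsupport (β j)))
    (((testSpace.hasCompactSupport hα₀).isCompact.union
      (testSpace.hasCompactSupport hβ₀).isCompact).union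
      (isCompact_iUnion fun j => (testSpace.hasCompactSupport (hα j)).isCompact.union
        (testSpace.hasCompactSupport (hβ j)).isCompact))
    (union_subset (union_subset hα₀.2 hβ₀.2)
      (iUnion_subset fun j => union_subset (hα j).2 (hβ j).2))
  set K : Set ℝ := Icc (a + δ) (b - δ) with hK
  have hKab : K ⊆ Ioo a b := fun x hx => ⟨by linarith [hx.1], by linarith [hx.2]⟩
  have hzero : ∀ {f : ℝ → ℝ}, tsupport f ⊆ K → ∀ x ∉ K, f x = 0 := fun hf x hx =>
    image_eq_zero_of_notMem_tsupport fun h => hx (hf h)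
  have sα₀ : tsupport α₀ ⊆ K := fun x hx => hKδ (Or.inl (Or.inl hx))
  have sβ₀ : tsupport β₀ ⊆ K := fun x hx => hKδ (Or.inl (Or.inr hx))
  have sα : ∀ j, tsupport (α j) ⊆ K := fun j x hx =>
    hKδ (Or.inr (mem_iUnion.2 ⟨j, Or.inl hx⟩))
  have sβ : ∀ j, tsupport (β j) ⊆ K := fun j x hx =>
    hKδ (Or.inr (mem_iUnion.2 ⟨j, Or.inr hx⟩))
  have zα : ∀ p, ∀ x ∉ K, comb α₀ α p x = 0 := fun p x hx => by
    simp [comb, hzero sα₀ x hx, fun j => hzero (sα j) x hx]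
  have zβ : ∀ p, ∀ x ∉ K, comb β₀ β p x = 0 := fun p x hx => by
    simp [comb, hzero sβ₀ x hx, fun j => hzero (sβ j) x hx]
  have zα' : ∀ p, ∀ x ∉ K, deriv (comb α₀ α p) x = 0 := fun p x hx => by
    rw [deriv_comb hα₀ hα]
    simp [comb, hzero (tsupport_deriv_subset.trans sα₀) x hx,
      fun j => hzero (tsupport_deriv_subset.trans (sα j)) x hx]
  -- the admissible parameters
  have hcα := contDiff_comb hα₀.1 fun j => (hα j).1
  have hcβ := contDiff_comb hβ₀.1 fun j => (hβ j).1
  have hcα' : ContDiff ℝ ∞ (fun q : (ℝ × (ι → ℝ)) × ℝ => deriv (comb α₀ α q.1) q.2) := by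
    simp only [deriv_comb hα₀ hα]
    exact contDiff_comb (testSpace.deriv_mem hα₀).1 fun j => (testSpace.deriv_mem (hα j)).1
  have hzlt : ∀ x ∈ Icc a b, z x ^ 2 < 1 := fun x hx => by
    have := C.pos x hx
    nlinarith [C.sq_add_sq x hx]
  have hO : IsOpen (((univ : Set (ℝ × (ι → ℝ))) ×ˢ Ioo a b) ∩
      (fun q : (ℝ × (ι → ℝ)) × ℝ => (z q.2 + comb β₀ β q.1 q.2) ^ 2) ⁻¹' Iio 1) := by
    refine ContinuousOn.isOpen_inter_preimage ?_ (isOpen_univ.prod isOpen_Ioo) isOpen_Iio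
    refine (ContinuousOn.add ?_ hcβ.continuous.continuousOn).pow 2
    exact C.smooth_z.continuousOn.comp continuous_snd.continuousOn
      fun q hq => Ioo_subset_Icc_self hq.2
  -- By compactness of K, one neighbourhood u of the zero parameter keeps the raised height in (-1,
  -- 1) over all of K; off K nothing moves.
  obtain ⟨u, v, hu, hv, h0u, hKv, huv⟩ := generalized_tube_lemma
    (isCompact_singleton (x := (0 : ℝ × (ι → ℝ)))) (isCompact_Icc (a := a + δ) (b := b - δ)) hO
    (by
      rintro ⟨p, x⟩ ⟨hp, hx⟩
      obtain rfl : p = 0 := hp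
      have hx' : x ∈ Ioo a b := hKab hx
      refine ⟨⟨mem_univ _, hx'⟩, ?_⟩
      simpa [comb_zero] using hzlt x (Ioo_subset_Icc_self hx'))
  have h0u' : (0 : ℝ × (ι → ℝ)) ∈ u := h0u rfl
  have hvab : K ⊆ v ∩ Ioo a b := fun x hx => ⟨hKv hx, hKab hx⟩
  have hvo : IsOpen (v ∩ Ioo a b) := hv.inter isOpen_Ioo
  have hlt : ∀ p ∈ u, ∀ x ∈ Icc a b, (z x + comb β₀ β p x) ^ 2 < 1 := fun p hp x hx => by
    by_cases hxK : x ∈ K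
    · exact (huv (⟨hp, hKv hxK⟩ : (p, x) ∈ u ×ˢ v)).2
    · rw [zβ p x hxK, add_zero]
      exact hzlt x hx
  -- smoothness of the displacement and of the constraints
  have hmaps : MapsTo Prod.snd (u ×ˢ (v ∩ Ioo a b)) (Icc a b) :=
    fun q hq => Ioo_subset_Icc_self hq.2.2
  have hzs : ContDiffOn ℝ ∞ (fun q : (ℝ × (ι → ℝ)) × ℝ => z q.2) (u ×ˢ (v ∩ Ioo a b)) :=
    C.smooth_z.comp contDiff_snd.contDiffOn hmaps
  have hAs : ContDiffOn ℝ ∞ (fun q : (ℝ × (ι → ℝ)) × ℝ => A q.2) (u ×ˢ (v ∩ Ioo a b)) :=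
    C.smooth_A.comp contDiff_snd.contDiffOn hmaps
  have hks : ContDiffOn ℝ ∞ (fun q : (ℝ × (ι → ℝ)) × ℝ => k q.2) (u ×ˢ (v ∩ Ioo a b)) :=
    C.smooth_k.comp contDiff_snd.contDiffOn hmaps
  have hz's : ContDiffOn ℝ ∞ (fun q : (ℝ × (ι → ℝ)) × ℝ => der a b z q.2)
      (u ×ˢ (v ∩ Ioo a b)) :=
    (C.smooth_z.smoothOn_der hab).comp contDiff_snd.contDiffOn hmaps
  have hdisp' : ContDiffOn ℝ ∞ (fun q : (ℝ × (ι → ℝ)) × ℝ =>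
      cylDisp e (A q.2) (z q.2) (comb α₀ α q.1 q.2) (comb β₀ β q.1 q.2))
      (u ×ˢ (v ∩ Ioo a b)) := by
    have hsq : ContDiffOn ℝ ∞ (fun q : (ℝ × (ι → ℝ)) × ℝ =>
        √(1 - (z q.2 + comb β₀ β q.1 q.2) ^ 2)) (u ×ˢ (v ∩ Ioo a b)) :=
      ContDiffOn.sqrt (contDiffOn_const.sub ((hzs.add hcβ.contDiffOn).pow 2)) fun q hq => by
        have := hlt q.1 hq.1 q.2 (Ioo_subset_Icc_self hq.2.2)
        linarith
    have hsq0 : ContDiffOn ℝ ∞ (fun q : (ℝ × (ι → ℝ)) × ℝ => √(1 - z q.2 ^ 2))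
        (u ×ˢ (v ∩ Ioo a b)) :=
      ContDiffOn.sqrt (contDiffOn_const.sub (hzs.pow 2)) fun q hq => by
        have := hzlt q.2 (Ioo_subset_Icc_self hq.2.2)
        linarith
    exact ((((hsq.mul (Real.contDiff_cos.comp hcα).contDiffOn).sub hsq0).smul hAs).add
      ((hsq.mul (Real.contDiff_sin.comp hcα).contDiffOn).smul (contDiffOn_const.cross hAs))).add
      (hcβ.contDiffOn.smul contDiffOn_const)
  have hdisp : ContDiffOn ℝ ∞ (fun q : (ℝ × (ι → ℝ)) × ℝ =>
      cylDisp e (A q.2) (z q.2) (comb α₀ α q.1 q.2) (comb β₀ β q.1 q.2)) (u ×ˢ univ) :=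
    contDiffOn_prod_univ_of_eq_zero hu hvo isClosed_Icc hvab hdisp' fun p _ x hx => by
      simp [zα p x hx, zβ p x hx]
  have hΨ : ∀ i, ContDiffOn ℝ ∞ (fun q : (ℝ × (ι → ℝ)) × ℝ =>
      cylConstraint a b e A z k (c i) (y i) (m i) (comb α₀ α q.1) (comb β₀ β q.1) q.2)
      (u ×ˢ univ) := fun i => by
    refine contDiffOn_prod_univ_of_eq_zero hu hvo isClosed_Icc hvab ?_ fun p _ x hx => by
      simp [cylConstraint, cylHol, zα p x hx, zβ p x hx, zα' p x hx]
    refine ((ContDiffOn.inner ℝ contDiffOn_const hdisp').add (contDiffOn_const.mul ?_)).add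
      (((hm i).comp contDiff_snd).mul hcα').contDiffOn
    exact ((hcβ.contDiffOn.mul hks).sub (hz's.mul hcα.contDiffOn)).add
      (hcβ.mul hcα').contDiffOn
  have hdispder : ∀ {f : ℝ → (ℝ × (ι → ℝ))} (x : ℝ) {α' β' : ℝ}, f 0 = 0 →
      HasDerivAt (fun t => comb α₀ α (f t) x) α' 0 →
      HasDerivAt (fun t => comb β₀ β (f t) x) β' 0 →
      HasDerivAt (fun t => cylDisp e (A x) (z x) (comb α₀ α (f t) x) (comb β₀ β (f t) x))
        (cylField e (A x) (ρ x) (z x) α' β') 0 := by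
    intro f x α' β' hf h1 h2
    by_cases hx : x ∈ Icc a b
    · exact hasDerivAt_cylDisp (C.pos x hx) (C.sq_add_sq x hx) h1 h2
        (by rw [hf, comb_zero]) (by rw [hf, comb_zero])
    · have hxK : x ∉ K := fun h => hx (Ioo_subset_Icc_self (hKab h))
      simp only [zα _ x hxK, zβ _ x hxK] at h1 h2 ⊢
      rw [h1.unique (hasDerivAt_const _ _), h2.unique (hasDerivAt_const _ _)]
      simpa using hasDerivAt_const (0 : ℝ) (0 : E3)
  set Φ : ℝ × (ι → ℝ) → (ι → ℝ) := fun p i => ∫ x in a..b,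
    cylConstraint a b e A z k (c i) (y i) (m i) (comb α₀ α p) (comb β₀ β p) x with hΦ
  have hΦs : ContDiffOn ℝ ∞ Φ u := contDiffOn_pi.2 fun i =>
    contDiffOn_intervalIntegral_param hu (hΨ i) hab.le
  have hΦ0 : Φ 0 = 0 := by
    ext i
    simp [hΦ, cylConstraint, cylHol, comb_zero, deriv_comb hα₀ hα]
  -- The derivative is evaluated along lines τ • q, where it is the linearized constraint of the
  -- combination q: `hbase` removes the first coordinate and `hdual` returns the others.
  have hΦ' : HasFDerivAt Φ (ContinuousLinearMap.snd ℝ ℝ (ι → ℝ)) 0 := by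
    have hd : HasFDerivAt Φ (fderiv ℝ Φ 0) 0 :=
      ((hΦs.contDiffAt (hu.mem_nhds h0u')).differentiableAt (by simp)).hasFDerivAt
    refine hd.congr_fderiv (ContinuousLinearMap.ext fun q => funext fun i => ?_)
    have hline : HasDerivAt (fun τ : ℝ => τ • q) q 0 := by
      simpa using (hasDerivAt_id (0 : ℝ)).smul_const q
    have h1 : HasDerivAt (fun τ : ℝ => Φ (τ • q)) (fderiv ℝ Φ 0 q) 0 :=
      hd.comp_hasDerivAt_of_eq 0 hline (by simp)
    have h2 := hasDerivAt_pi.1 h1 i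
    have h3 : HasDerivAt (fun τ : ℝ => Φ (τ • q) i) (∫ x in a..b,
        cylConstraintLin a b e A ρ z k (c i) (y i) (m i) (comb α₀ α q) (comb β₀ β q) x) 0 := by
      refine hasDerivAt_intervalIntegral_param (s := (fun τ : ℝ => τ • q) ⁻¹' u)
        (hu.preimage (by fun_prop)) (by simpa using h0u')
        ((hΨ i).comp (f := fun w : ℝ × ℝ => (w.1 • q, w.2)) (ContDiff.contDiffOn (by fun_prop))
          fun w hw => ⟨hw.1, mem_univ _⟩) fun x => ?_
      have lin : ∀ r : ℝ, HasDerivAt (fun τ : ℝ => τ * r) r 0 := fun r => by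
        simpa using (hasDerivAt_id (0 : ℝ)).mul_const r
      have l1 := lin (comb α₀ α q x)
      have l2 := lin (comb β₀ β q x)
      have l3 := lin (deriv (comb α₀ α q) x)
      have hsm : ∀ τ : ℝ, deriv (comb α₀ α (τ • q)) x = τ * deriv (comb α₀ α q) x := fun τ => by
        rw [deriv_comb hα₀ hα, deriv_comb hα₀ hα, comb_smul]
      have l4 := hdispder (f := fun τ : ℝ => τ • q) x (by simp) (by simpa only [comb_smul] using l1)
        (by simpa only [comb_smul] using l2)
      have l5 := (((hasDerivAt_const (0 : ℝ) (c i)).inner ℝ l4).add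
        ((((l2.mul_const (k x)).sub (l1.const_mul (der a b z x))).add (l2.mul l3)).const_mul
          (y i))).add (l3.const_mul (m i x))
      refine (l5.congr_of_eventuallyEq (.of_forall fun τ => ?_)).congr_deriv ?_
      · simp only [cylConstraint, cylHol, comb_smul, hsm, Pi.add_apply, Pi.sub_apply, Pi.mul_apply]
      · simp [cylConstraintLin]
    rw [h2.unique h3]
    simp only [cylConstraintLin_comb hα₀ hα]
    rw [integral_comb
      (SmoothOn.intervalIntegrable hab
        (C.smoothOn_cylConstraintLin hab _ _ (hm i).contDiffOn hα₀ hβ₀))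
      (fun j => SmoothOn.intervalIntegrable hab
        (C.smoothOn_cylConstraintLin hab _ _ (hm i).contDiffOn (hα j) (hβ j)))]
    simp [hbase, hdual]
  -- solve the constraints along a curve of parameters
  obtain ⟨ε, hε, g, hgs, hg0, hg', hgu⟩ := exists_curve_of_hasFDerivAt_snd hu h0u' hΦs hΦ0 hΦ'
  -- As g has derivative 0 at 0, the correctors do not affect the velocity, which is that of the
  -- base direction alone.
  have hcombder : ∀ (f₀ : ℝ → ℝ) (f : ι → ℝ → ℝ) (x : ℝ),
      HasDerivAt (fun t => comb f₀ f (t, g t) x) (f₀ x) 0 := fun f₀ f x => by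
    have h1 : HasDerivAt (fun t : ℝ => t * f₀ x) (f₀ x) 0 := by
      simpa using (hasDerivAt_id (0 : ℝ)).mul_const (f₀ x)
    have h2 := h1.add (HasDerivAt.fun_sum (u := Finset.univ) fun j _ =>
      (hasDerivAt_pi.1 hg' j).mul_const (f j x))
    refine h2.congr_deriv ?_
    simp
  have h00 : ((0 : ℝ), g 0) = (0 : ℝ × (ι → ℝ)) := by rw [hg0]; rfl
  refine hel.integral_inner_eq_zero hab hγ hϱ harc hε (δ := δ)
    (D := fun t x => cylDisp e (A x) (z x) (comb α₀ α (t, g t) x) (comb β₀ β (t, g t) x))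
    ?_ (fun x => by simp only [h00, comb_zero, cylDisp_zero]) hδ
    (fun t _ x hx => by simp only [zα _ x hx, zβ _ x hx, cylDisp_zero])
    (fun t ht x hx => ((C.varied (comb_mem hα₀ hα _).1 (comb_mem hβ₀ hβ _).1
      (hlt _ (hgu t ht).1)).norm_eq_one hx))
    (fun t ht => (hcon (t, g t) fun i => congrFun (hgu t ht).2 i).1)
    (fun t ht γ' _ hγ' Wa Wb θ => C.hasHolonomy_varied_iff hab harc (comb_mem hα₀ hα _)
      (comb_mem hβ₀ hβ _) (hlt _ (hgu t ht).1) hγ'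
      (hcon (t, g t) fun i => congrFun (hgu t ht).2 i).2 Wa Wb θ)
    (fun x => hdispder (f := fun t => (t, g t)) x h00 (hcombder α₀ α x) (hcombder β₀ β x))
  exact hdisp.comp (f := fun w : ℝ × ℝ => ((w.1, g w.1), w.2))
    ((contDiff_fst.contDiffOn.prodMk (hgs.comp contDiff_fst.contDiffOn fun w hw => hw.1)).prodMk
      contDiff_snd.contDiffOn) fun w hw => ⟨(hgu w.1 hw.1).1, mem_univ _⟩

end FamilyOfVariations

/-! ### Normal fields, choice of the axis and the independent case. -/

section Fields

open MeasureTheory Topology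

variable {a b : ℝ}

theorem testSpace.mem_of_smoothOn {F F' : Type*} [NormedAddCommGroup F] [NormedSpace ℝ F]
    [NormedAddCommGroup F'] [NormedSpace ℝ F'] {U : ℝ → F} (hU : U ∈ testSpace a b F)
    {f : ℝ → F'} (hf : SmoothOn a b f) (h0 : ∀ x, U x = 0 → f x = 0) : f ∈ testSpace a b F' := by
  have h : ∀ x ∉ tsupport U, f x = 0 := fun x hx => h0 x (image_eq_zero_of_notMem_tsupport hx)
  refine ⟨contDiff_of_eq_zero isOpen_Ioo (isClosed_tsupport U) hU.2
    (hf.mono Ioo_subset_Icc_self) h, ?_⟩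
  refine (closure_minimal (fun x hx => ?_) (isClosed_tsupport U)).trans hU.2
  by_contra hx'
  exact hx (h x hx')

/-- An integral vanishes if enough of its components do. -/
theorem integral_eq_zero_of_inner {κ : Type*} {c : κ → E3}
    (hc : ∀ v : E3, (∀ i, inner ℝ (c i) v = 0) → v = 0) {f : ℝ → E3} (hab : a ≤ b)
    (h : ∀ i, ∫ x in a..b, inner ℝ (c i) (f x) = 0) : ∫ x in a..b, f x = 0 := by
  by_cases hf : IntervalIntegrable f volume a b
  · refine hc _ fun i => ?_
    rw [← h i, intervalIntegral.integral_of_le hab, intervalIntegral.integral_of_le hab]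
    exact (integral_inner ((intervalIntegrable_iff_integrableOn_Ioc_of_le hab).1 hf) (c i)).symm
  -- The integral of a non-integrable function is 0 by convention.
  · exact intervalIntegral.integral_undef hf

theorem E3.eq_zero_of_inner_single (v : E3)
    (h : ∀ i : Fin 3, inner ℝ (EuclideanSpace.single i (1 : ℝ)) v = 0) : v = 0 := by
  ext i
  simpa [EuclideanSpace.inner_single_left] using h i

/-- Cylindrical coordinates about an axis that the unit tangent avoids. -/
theorem exists_isCylindrical (hab : a < b) {T : ℝ → E3} (hT : SmoothOn a b T)
    (hT1 : ∀ x ∈ Icc a b, ‖T x‖ = 1) {e : E3} (he : inner ℝ e e = 1)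
    (hlt : ∀ x ∈ Icc a b, inner ℝ (T x) e ^ 2 < 1) :
    ∃ (A : ℝ → E3) (ρ k : ℝ → ℝ), IsCylindrical a b T e A ρ (fun x => inner ℝ (T x) e) k := by
  set z : ℝ → ℝ := fun x => inner ℝ (T x) e with hz
  set ρ : ℝ → ℝ := fun x => √(1 - z x ^ 2) with hρ
  set A : ℝ → E3 := fun x => (ρ x)⁻¹ • (T x - z x • e) with hA
  have hpos : ∀ x ∈ Icc a b, 0 < 1 - z x ^ 2 := fun x hx => by linarith [hlt x hx]
  have hρpos : ∀ x ∈ Icc a b, 0 < ρ x := fun x hx => Real.sqrt_pos.2 (hpos x hx)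
  have hρsq : ∀ x ∈ Icc a b, ρ x ^ 2 = 1 - z x ^ 2 := fun x hx => Real.sq_sqrt (hpos x hx).le
  have hzs : SmoothOn a b z := ContDiffOn.inner ℝ hT contDiffOn_const
  have hρs : SmoothOn a b ρ :=
    ContDiffOn.sqrt (contDiffOn_const.sub (hzs.pow 2)) fun x hx => (hpos x hx).ne'
  have hAs : SmoothOn a b A := (hρs.inv fun x hx => (hρpos x hx).ne').smul
    (hT.sub (hzs.smul contDiffOn_const))
  have hTT : ∀ x ∈ Icc a b, inner ℝ (T x) (T x) = 1 := fun x hx => by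
    rw [real_inner_self_eq_norm_sq, hT1 x hx, one_pow]
  have hAA : ∀ x ∈ Icc a b, inner ℝ (A x) (A x) = 1 := fun x hx => by
    have h1 : inner ℝ e (T x) = z x := real_inner_comm _ _
    have h2 : inner ℝ (T x) e = z x := rfl
    simp only [hA, inner_smul_left, inner_smul_right, inner_sub_left, inner_sub_right, conj_trivial,
      hTT x hx, he, h1, h2]
    have := (hρpos x hx).ne'
    field_simp
    linarith [hρsq x hx]
  have hAe : ∀ x ∈ Icc a b, inner ℝ (A x) e = 0 := fun x hx => by
    simp only [hA, inner_smul_left, inner_sub_left, conj_trivial, he]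
    simp [hz]
  -- Since A is a unit field orthogonal to e, its derivative is orthogonal to A and e, hence a
  -- multiple of e × A; the coefficient is k.
  refine ⟨A, ρ, fun x => inner ℝ (der a b A x) (cross e (A x)), he, hAs, hρs, hzs,
    ContDiffOn.inner ℝ (hAs.smoothOn_der hab) (contDiffOn_const.cross hAs), hAA, hAe, hρpos,
    fun x hx => by rw [hρsq x hx]; ring, fun x hx => ?_, fun x hx => ?_⟩
  · simp only [hA]
    rw [smul_inv_smul₀ (hρpos x hx).ne']
    module
  · have hd := hAs.hasDerivWithinAt hx
    have h1 : inner ℝ (der a b A x) e = 0 := by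
      have h := hd.inner ℝ (hasDerivWithinAt_const x (Icc a b) e)
      have h' := (hasDerivWithinAt_const x (Icc a b) (0 : ℝ)).congr hAe (hAe x hx)
      have := (h.der_eq hab hx).symm.trans (h'.der_eq hab hx)
      simpa using this
    have h2 : inner ℝ (der a b A x) (A x) = 0 := by
      have h := hd.inner ℝ hd
      have h' := (hasDerivWithinAt_const x (Icc a b) (1 : ℝ)).congr hAA (hAA x hx)
      have := (h.der_eq hab hx).symm.trans (h'.der_eq hab hx)
      rw [real_inner_comm] at this
      linarith
    have h3 := orthonormal_expansion he (hAA x hx) (hAe x hx) (der a b A x)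
    rw [h1, h2, zero_smul, zero_smul, zero_add, zero_add] at h3
    rw [← h3]
    exact hd

namespace IsCylindrical

variable {T : ℝ → E3} {e : E3} {A : ℝ → E3} {ρ z k : ℝ → ℝ}

/-- Fields normal to `T` are first order parts of cylindrical variations. -/
theorem cylField_eq (h : IsCylindrical a b T e A ρ z k) {x : ℝ} (hx : x ∈ Icc a b) {v : E3}
    (hv : inner ℝ v (T x) = 0) :
    cylField e (A x) (ρ x) (z x) (inner ℝ v (cross e (A x)) / ρ x) (inner ℝ v e) = v := by
  have h1 := orthonormal_expansion h.axis (h.unit x hx) (h.horizontal x hx) v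
  have hρ := (h.pos x hx).ne'
  rw [h.eq x hx, inner_add_right, inner_smul_right, inner_smul_right] at hv
  have h2 : inner ℝ v (A x) = -(inner ℝ v e * (z x / ρ x)) := by
    field_simp
    linarith
  conv_rhs => rw [h1]
  rw [cylField, div_mul_cancel₀ _ hρ, h2]
  module

theorem deriv_T (hab : a < b) (h : IsCylindrical a b T e A ρ z k) {x : ℝ} (hx : x ∈ Icc a b) :
    der a b T x = der a b ρ x • A x + (ρ x * k x) • cross e (A x) + der a b z x • e := by
  rw [der_congr h.eq hx]
  refine HasDerivWithinAt.der_eq hab ?_ hx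
  refine (((h.smooth_ρ.hasDerivWithinAt hx).smul (h.deriv_A x hx)).add
    ((h.smooth_z.hasDerivWithinAt hx).smul_const e)).congr_deriv ?_
  module

/-- The linearized holonomy. -/
theorem inner_cylField_cross (hab : a < b) (h : IsCylindrical a b T e A ρ z k) {x : ℝ}
    (hx : x ∈ Icc a b) (α β : ℝ) :
    inner ℝ (cylField e (A x) (ρ x) (z x) α β) (cross (T x) (der a b T x)) =
      β * k x - der a b z x * α := by
  have hρ := (h.pos x hx).ne'
  have he := h.axis
  have hA := h.unit x hx
  have hAe := h.horizontal x hx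
  have heA : inner ℝ e (A x) = 0 := by rw [real_inner_comm]; exact hAe
  have hsq := h.sq_add_sq x hx
  have hd := h.deriv_ρ hab hx
  have c1 : cross (A x) (cross e (A x)) = e := by
    rw [cross_cross_left, hA, hAe]; module
  have c2 : cross e (cross e (A x)) = -A x := by
    rw [cross_cross_left, he, heA]; module
  have c3 : cross (A x) e = -cross e (A x) := cross_swap _ _
  have hc : cross (T x) (der a b T x) = (-(z x * ρ x * k x)) • A x +
      (z x * der a b ρ x - ρ x * der a b z x) • cross e (A x) + (ρ x ^ 2 * k x) • e := by
    rw [h.deriv_T hab hx, h.eq x hx]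
    simp only [cross_add_left, cross_add_right, cross_smul_left, cross_smul_right,
      cross_self_eq_zero, c1, c2, c3]
    module
  have n1 : inner ℝ (cross e (A x)) e = 0 := by rw [real_inner_comm]; simp
  have n2 : inner ℝ (cross e (A x)) (A x) = 0 := by rw [real_inner_comm]; simp
  rw [hc, cylField]
  simp only [inner_add_left, inner_add_right, inner_smul_left, inner_smul_right, inner_sub_left,
    conj_trivial, inner_cross_self_left, inner_cross_self_right, inner_cross_cross, n1, n2, he, hA,
    hAe, heA]
  have hq := div_mul_cancel₀ (z x) hρ
  linear_combination (β * k x - der a b z x * α) * hsq + α * z x * hd + β * k x * z x * hq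

end IsCylindrical

namespace IsCylindrical

variable {T : ℝ → E3} {e : E3} {A : ℝ → E3} {ρ z k : ℝ → ℝ}

/-- The velocity U × T is normal to T, hence produced by a turn and a raise. The formula for β is
kept because ∫β is the axial component of the closure condition. -/
theorem exists_cylField_eq (C : IsCylindrical a b T e A ρ z k) (hT : SmoothOn a b T) {U : ℝ → E3}
    (hU : U ∈ testSpace a b E3) :
    ∃ α ∈ testSpace a b ℝ, ∃ β ∈ testSpace a b ℝ, (∀ x ∈ Icc a b,
      cylField e (A x) (ρ x) (z x) (α x) (β x) = cross (U x) (T x)) ∧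
      ∀ x, β x = inner ℝ (cross (U x) (T x)) e := by
  have hs := (testSpace.smoothOn hU).cross hT
  refine ⟨fun x => inner ℝ (cross (U x) (T x)) (cross e (A x)) / ρ x, ?_,
    fun x => inner ℝ (cross (U x) (T x)) e, ?_,
    fun x hx => C.cylField_eq hx (by rw [real_inner_comm, inner_cross_self_right]), fun _ => rfl⟩
  · exact testSpace.mem_of_smoothOn hU ((ContDiffOn.inner ℝ hs C.smooth_n).div C.smooth_ρ
      fun x hx => (C.pos x hx).ne') fun x hx => by simp [hx]
  · exact testSpace.mem_of_smoothOn hU (ContDiffOn.inner ℝ hs contDiffOn_const)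
      fun x hx => by simp [hx]

end IsCylindrical

theorem inner_der_self_eq_zero (hab : a < b) {T : ℝ → E3} (hT : SmoothOn a b T)
    (hT1 : ∀ x ∈ Icc a b, inner ℝ (T x) (T x) = 1) {x : ℝ} (hx : x ∈ Icc a b) :
    inner ℝ (T x) (der a b T x) = 0 := by
  have hd := hT.hasDerivWithinAt hx
  have h := hd.inner ℝ hd
  have h' := (hasDerivWithinAt_const x (Icc a b) (1 : ℝ)).congr hT1 (hT1 x hx)
  have := (h.der_eq hab hx).symm.trans (h'.der_eq hab hx)
  rw [real_inner_comm (T x)] at this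
  linarith

/-- The densities, with respect to a rotation field, of the constraints. -/
noncomputable def constraintDensity (T T' : E3) : Option (Fin 3) → E3
  | some i => cross T (EuclideanSpace.single i 1)
  -- The linearized holonomy of U × T is the integral of ⟨U × T, T × T'⟩, which equals -⟨U, T'⟩
  -- because T is a unit vector orthogonal to T'.
  | none => -T'

theorem integral_inner_cross_eq_zero (hab : a < b) {T U : ℝ → E3} (hT : SmoothOn a b T)
    (hU : U ∈ testSpace a b E3)
    (h : ∀ i : Fin 3, ∫ x in a..b, inner ℝ (U x) (cross (T x) (EuclideanSpace.single i 1)) = 0)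
    (c : E3) : ∫ x in a..b, inner ℝ c (cross (U x) (T x)) = 0 := by
  have hs : SmoothOn a b (fun x => cross (U x) (T x)) := (testSpace.smoothOn hU).cross hT
  have h0 : ∫ x in a..b, cross (U x) (T x) = 0 :=
    integral_eq_zero_of_inner E3.eq_zero_of_inner_single hab.le fun i => by
      rw [← h i]
      refine intervalIntegral.integral_congr fun x _ => ?_
      rw [inner_cross_cyclic, real_inner_comm, inner_cross_cyclic, real_inner_comm]
  rw [intervalIntegral.integral_of_le hab.le] at h0 ⊢
  rw [integral_inner ((intervalIntegrable_iff_integrableOn_Ioc_of_le hab.le).1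
    (hs.intervalIntegrable hab)) c, h0, inner_zero_right]

variable {γ : ℝ → E3} {ϱ : ℝ → ℝ}

/-- The first variation vanishes in all admissible directions if the linearized constraints are
independent. -/
theorem IsHolonomyConstrainedElastic.integral_eq_zero_of_independent (hab : a < b)
    (hγ : IsCurve a b γ) (hϱ : IsStiffness a b ϱ) (harc : IsArcLength a b γ)
    (hel : IsHolonomyConstrainedElastic a b ϱ γ) {e : E3} {A : ℝ → E3} {ρ z k : ℝ → ℝ}
    (C : IsCylindrical a b (der a b γ) e A ρ z k)
    (hind : ∀ c : Option (Fin 3) → ℝ, (∀ x ∈ Ioo a b,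
      ∑ i, c i • constraintDensity (der a b γ x) (der a b (der a b γ) x) i = 0) → c = 0)
    {U : ℝ → E3} (hU : U ∈ testSpace a b E3)
    (hU0 : ∀ i, ∫ x in a..b, inner ℝ (U x)
      (constraintDensity (der a b γ x) (der a b (der a b γ) x) i) = 0) :
    ∫ x in a..b, inner ℝ (cross (U x) (der a b γ x))
      (der a b (fun y => ϱ y • der a b (der a b γ) y) x) = 0 := by
  have hTs : SmoothOn a b (der a b γ) := hγ.smooth.smoothOn_der hab
  have hT's := hTs.smoothOn_der hab
  have hcont : ∀ i, ContinuousOn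
      (fun x => constraintDensity (der a b γ x) (der a b (der a b γ) x) i) (Icc a b)
    | some i => ContDiffOn.continuousOn (n := ∞) (hTs.cross contDiffOn_const)
    | none => hT's.continuousOn.neg
  obtain ⟨W, hW, hWd⟩ := exists_dual_testFunctions hab.le hcont hind
  obtain ⟨α₀, hα₀, β₀, hβ₀, hfield₀, -⟩ := C.exists_cylField_eq hTs hU
  choose α hα β hβ hfield _ using fun j => C.exists_cylField_eq hTs (hW j)
  have hlin : ∀ (U : ℝ → E3) (α β : ℝ → ℝ), (∀ x ∈ Icc a b,
      cylField e (A x) (ρ x) (z x) (α x) (β x) = cross (U x) (der a b γ x)) →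
      ∀ i : Option (Fin 3), ∫ x in a..b, cylConstraintLin a b e A ρ z k
        (i.elim 0 fun j => EuclideanSpace.single j 1) (i.elim 1 fun _ => 0) (fun _ => 0) α β x =
      ∫ x in a..b, inner ℝ (U x)
        (constraintDensity (der a b γ x) (der a b (der a b γ) x) i) := fun U α β hf i => by
    refine intervalIntegral.integral_congr fun x hx => ?_
    rw [uIcc_of_le hab.le] at hx
    have hTT : ∀ x ∈ Icc a b, inner ℝ (der a b γ x) (der a b γ x) = 1 := fun x hx => by
      rw [real_inner_self_eq_norm_sq, harc x hx, one_pow]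
    have h1 := inner_der_self_eq_zero hab hTs hTT hx
    simp only [cylConstraintLin]
    rw [hf x hx, ← C.inner_cylField_cross hab hx, hf x hx]
    rcases i with _ | i
    · simp [constraintDensity, inner_cross_cross, harc x hx, h1]
    · simp only [Option.elim_some, constraintDensity, zero_mul, add_zero]
      rw [inner_cross_cyclic, real_inner_comm, inner_cross_cyclic, real_inner_comm]
  have key := hel.integral_inner_cylField_eq_zero hab hγ hϱ harc C hα₀ hβ₀ hα hβ
    (c := fun i => i.elim 0 fun j => EuclideanSpace.single j 1)
    (y := fun i => i.elim 1 fun _ => 0) (m := fun _ _ => 0) (fun _ => contDiff_const)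
    (fun i => by rw [hlin U _ _ hfield₀]; exact hU0 i)
    (fun i j => by rw [hlin (W j) _ _ (hfield j)]; exact hWd i j)
    (fun p hp => by
      refine ⟨integral_eq_zero_of_inner E3.eq_zero_of_inner_single hab.le fun i => ?_, ?_⟩
      · simpa [cylConstraint] using hp (some i)
      · simpa [cylConstraint] using hp none)
  rw [← key]
  refine intervalIntegral.integral_congr fun x hx => ?_
  rw [uIcc_of_le hab.le] at hx
  rw [hfield₀ x hx]

/-- Some axis is avoided by a smooth unit field on an interval. -/
theorem exists_axis (hab : a < b) {T : ℝ → E3} (hT : SmoothOn a b T)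
    (hT1 : ∀ x ∈ Icc a b, ‖T x‖ = 1) :
    ∃ e : E3, inner ℝ e e = 1 ∧ ∀ x ∈ Icc a b, inner ℝ (T x) e ^ 2 < 1 := by
  -- The lines spanned by the vectors T x sweep out a C¹ image of a planar set, of Hausdorff
  -- dimension at most two, so some vector of space lies on none of them.
  have hs : ContDiffOn ℝ 1 (fun q : ℝ × ℝ => q.1 • T q.2) (univ ×ˢ Icc a b) :=
    contDiff_fst.contDiffOn.smul ((hT.of_le (by simp)).comp contDiff_snd.contDiffOn
      fun q hq => hq.2)
  have hd : Dense ((fun q : ℝ × ℝ => q.1 • T q.2) '' (univ ×ˢ Icc a b))ᶜ := by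
    refine hs.dense_compl_image_of_dimH_lt_finrank (convex_univ.prod (convex_Icc a b)) le_rfl ?_
    calc dimH ((univ : Set ℝ) ×ˢ Icc a b) ≤ dimH (univ : Set (ℝ × ℝ)) := dimH_mono (subset_univ _)
      _ = 2 := by rw [Real.dimH_univ_eq_finrank]; simp
      _ < _ := by simp; norm_num
  obtain ⟨v, hv⟩ := hd.nonempty
  have ha : a ∈ Icc a b := left_mem_Icc.2 hab.le
  have hv0 : v ≠ 0 := fun h => hv ⟨(0, a), ⟨mem_univ _, ha⟩, by simp [h]⟩
  have hvn : ‖v‖ ≠ 0 := norm_ne_zero_iff.2 hv0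
  have he1 : ‖‖v‖⁻¹ • v‖ = 1 := by rw [norm_smul, norm_inv, norm_norm, inv_mul_cancel₀ hvn]
  refine ⟨‖v‖⁻¹ • v, by rw [real_inner_self_eq_norm_sq, he1, one_pow], fun x hx => ?_⟩
  set e := ‖v‖⁻¹ • v with he
  have hsub : ‖e - inner ℝ (T x) e • T x‖ ^ 2 = 1 - inner ℝ (T x) e ^ 2 := by
    rw [norm_sub_sq_real, he1, norm_smul, hT1 x hx, inner_smul_right, real_inner_comm e,
      Real.norm_eq_abs, mul_one, sq_abs]
    ring
  have hne : e - inner ℝ (T x) e • T x ≠ 0 := fun h => by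
    refine hv ⟨(‖v‖ * inner ℝ (T x) e, x), ⟨mem_univ _, hx⟩, ?_⟩
    dsimp only
    rw [mul_smul, ← sub_eq_zero.1 h, he, smul_inv_smul₀ hvn]
  have := pow_pos (norm_pos_iff.2 hne) 2
  linarith

end Fields

/-! ### The degenerate case of a uniformly turning tangent. -/

section Helix

open MeasureTheory Topology

variable {a b : ℝ} {T : ℝ → E3} {e : E3} {A : ℝ → E3} {ρ z k : ℝ → ℝ} {w : ℝ}

theorem testSpace.integral_mul_deriv_self (hab : a < b) {α : ℝ → ℝ} (hα : α ∈ testSpace a b ℝ) :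
    ∫ x in a..b, α x * deriv α x = 0 := by
  have h := integral_deriv_mul_test hab (testSpace.smoothOn hα) hα
  have h2 : ∫ x in a..b, der a b α x * α x = ∫ x in a..b, α x * deriv α x := by
    refine intervalIntegral.integral_congr fun x hx => ?_
    rw [uIcc_of_le hab.le] at hx
    rw [(testSpace.hasDerivAt hα x).hasDerivWithinAt.der_eq hab hx, mul_comm]
  rw [h2] at h
  linarith

/-- Two horizontal directions, and a placeholder. -/
noncomputable def horizontalPair (e A : E3) : Option Bool → E3
  | some true => A
  | some false => cross e A
  | none => 0

/-- The weight of the rate of turning in the constraints. -/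
def turningWeight (m : ℝ → ℝ) : Option Bool → ℝ → ℝ
  | some _ => fun _ => 0
  | none => m

namespace IsCylindrical

theorem eq_zero_of_inner (hab : a < b) (C : IsCylindrical a b T e A ρ z k) {v : E3}
    (h1 : inner ℝ (A a) v = 0) (h2 : inner ℝ (cross e (A a)) v = 0) (h3 : inner ℝ e v = 0) :
    v = 0 := by
  have ha := left_mem_Icc.2 hab.le
  have h := orthonormal_expansion C.axis (C.unit a ha) (C.horizontal a ha) v
  rw [real_inner_comm] at h1 h2 h3
  rw [h, h1, h2, h3]
  simp

/-- Correctors for the constraints of a curve with uniformly turning tangent. -/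
theorem exists_turning_correctors (hab : a < b) (C : IsCylindrical a b T e A ρ z k) (hw : w ≠ 0)
    (hk : ∀ x ∈ Icc a b, k x = w) {m : ℝ → ℝ} (hm : m ∈ testSpace a b ℝ) (hm0 : m ≠ 0) :
    ∃ α : Option Bool → ℝ → ℝ, (∀ j, α j ∈ testSpace a b ℝ) ∧
      ∀ i j, ∫ x in a..b, cylConstraintLin a b e A ρ z k (horizontalPair e (A a) i) 0
        (turningWeight m i) (α j) (fun _ => 0) x = if i = j then 1 else 0 := by
  classical
  have ha := left_mem_Icc.2 hab.le
  have hAA := C.unit a ha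
  have hAe := C.horizontal a ha
  have heA : inner ℝ e (A a) = 0 := by rw [real_inner_comm]; exact hAe
  have hn1 : inner ℝ (cross e (A a)) (A a) = 0 := by rw [real_inner_comm]; simp
  have hn2 : inner ℝ (cross e (A a)) e = 0 := by rw [real_inner_comm]; simp
  have hm's := testSpace.deriv_mem hm
  set φ : Option Bool → ℝ → ℝ := fun i x => i.elim (-deriv m x) fun t =>
    ρ x * inner ℝ (horizontalPair e (A a) (some t)) (cross e (A x)) with hφ
  have hφc : ∀ i, ContinuousOn (φ i) (Icc a b)
    | none => (testSpace.smoothOn hm's).continuousOn.neg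
    | some t => (C.smooth_ρ.mul (ContDiffOn.inner ℝ contDiffOn_const C.smooth_n)).continuousOn
  obtain ⟨α, hα, hαd⟩ := exists_dual_testFunctions hab.le hφc (by
    intro c hc
    -- Near a the weight m vanishes, so a linear relation says ⟨g, e × A⟩ = 0 there, with g its
    -- horizontal coefficient vector. Differentiating and using k = w ≠ 0 gives ⟨g, A⟩ = 0, so g =
    -- 0. What remains is a multiple of m', and m' = 0 would force m = 0.
    obtain ⟨δ, hδ, hδK⟩ := exists_Icc_of_isCompact (testSpace.hasCompactSupport hm).isCompact hm.2
    set g : E3 := c (some true) • A a + c (some false) • cross e (A a) with hg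
    have hsum : ∀ x ∈ Ioo a b, c none * -deriv m x + ρ x * inner ℝ g (cross e (A x)) = 0 :=
      fun x hx => by
        rw [← hc x hx]
        simp only [hφ, hg, Fintype.sum_option, Fintype.sum_bool, Option.elim, horizontalPair,
          inner_add_left, inner_smul_left, conj_trivial, smul_eq_mul]
        ring
    have hgn : ∀ x ∈ Ioo a (min (a + δ) b), inner ℝ g (cross e (A x)) = 0 := fun x hx => by
      have hxb : x ∈ Ioo a b := ⟨hx.1, hx.2.trans_le (min_le_right _ _)⟩
      have hx0 : deriv m x = 0 := image_eq_zero_of_notMem_tsupport fun h => by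
        have := (hδK (tsupport_deriv_subset h)).1
        linarith [hx.2.trans_le (min_le_left (a + δ) b)]
      have := hsum x hxb
      rw [hx0] at this
      simpa [(C.pos x (Ioo_subset_Icc_self hxb)).ne'] using this
    obtain ⟨x₀, hx₀⟩ : (Ioo a (min (a + δ) b)).Nonempty :=
      nonempty_Ioo.2 (lt_min (by linarith) hab)
    have hx₀b : x₀ ∈ Ioo a b := ⟨hx₀.1, hx₀.2.trans_le (min_le_right _ _)⟩
    have hx₀c := Ioo_subset_Icc_self hx₀b
    have hgA : inner ℝ g (A x₀) = 0 := by
      have h1 := (hasDerivAt_const x₀ g).inner ℝ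
        ((C.deriv_n hx₀c).hasDerivAt (Icc_mem_nhds hx₀b.1 hx₀b.2))
      have h2 := h1.unique ((hasDerivAt_const x₀ (0 : ℝ)).congr_of_eventuallyEq (by
        filter_upwards [isOpen_Ioo.mem_nhds hx₀] with y hy using hgn y hy))
      simpa [inner_smul_right, hk x₀ hx₀c, hw] using h2
    have hge : inner ℝ g e = 0 := by
      simp [hg, inner_add_left, inner_smul_left, hAe, hn2]
    have hg0 : g = 0 := by
      rw [orthonormal_expansion C.axis (C.unit x₀ hx₀c) (C.horizontal x₀ hx₀c) g, hge, hgA,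
        hgn x₀ hx₀]
      simp
    have hc1 : c (some true) = 0 := by
      have : inner ℝ g (A a) = 0 := by rw [hg0, inner_zero_left]
      simpa only [hg, inner_add_left, inner_smul_left, conj_trivial, hAA, hn1, mul_one, mul_zero,
        add_zero] using this
    have hc2 : c (some false) = 0 := by
      have : inner ℝ g (cross e (A a)) = 0 := by rw [hg0, inner_zero_left]
      simpa only [hg, inner_add_left, inner_smul_left, conj_trivial, inner_cross_self_right,
        inner_cross_cross, C.axis, hAA, heA, hAe, mul_one, mul_zero, sub_zero, zero_add] using this
    have hc0 : c none = 0 := by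
      by_contra hne
      have hm' : ∀ x, deriv m x = 0 := fun x => by
        by_cases hx : x ∈ Ioo a b
        · have := hsum x hx
          rw [hg0] at this
          simpa [hne] using this
        · exact testSpace.eq_zero hm's hx
      refine hm0 (funext fun x => ?_)
      rw [is_const_of_deriv_eq_zero (hm.1.differentiable (by simp)) hm' x a,
        testSpace.eq_zero hm (by simp)]
      rfl
    funext i
    rcases i with _ | _ | _
    · exact hc0
    · exact hc2
    · exact hc1)
  refine ⟨α, hα, fun i j => ?_⟩
  rw [← hαd i j]
  rcases i with _ | t
  · have h := integral_deriv_mul_test hab (testSpace.smoothOn hm) (hα j)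
    simp only [cylConstraintLin, turningWeight, horizontalPair, inner_zero_left, zero_mul,
      zero_add]
    rw [h, ← intervalIntegral.integral_neg]
    refine intervalIntegral.integral_congr fun x hx => ?_
    rw [uIcc_of_le hab.le] at hx
    rw [(testSpace.hasDerivAt hm x).hasDerivWithinAt.der_eq hab hx]
    simp [hφ]
  · refine intervalIntegral.integral_congr fun x _ => ?_
    simp only [cylConstraintLin, turningWeight, cylField, zero_smul, add_zero, zero_mul,
      inner_smul_right, hφ, Option.elim_some, RCLike.inner_apply, conj_trivial]
    ring

end IsCylindrical

variable {γ : ℝ → E3} {ϱ : ℝ → ℝ}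

/-- The first variation of a curve with uniformly turning tangent, in directions isotropic for the
second variation of the holonomy. -/
theorem IsHolonomyConstrainedElastic.integral_eq_zero_of_isotropic (hab : a < b)
    (hγ : IsCurve a b γ) (hϱ : IsStiffness a b ϱ) (harc : IsArcLength a b γ)
    (hel : IsHolonomyConstrainedElastic a b ϱ γ) (C : IsCylindrical a b (der a b γ) e A ρ z k)
    (hw : w ≠ 0) (hk : ∀ x ∈ Icc a b, k x = w) (hz : ∀ x ∈ Icc a b, der a b z x = 0)
    {m α₀ β₀ : ℝ → ℝ} (hm : m ∈ testSpace a b ℝ) (hm0 : m ≠ 0) (hα₀ : α₀ ∈ testSpace a b ℝ)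
    (hβ₀ : β₀ = 0 ∨ β₀ = m) (hβ₀i : ∫ x in a..b, β₀ x = 0)
    (hV : ∀ c : E3, ∫ x in a..b, inner ℝ c (cylField e (A x) (ρ x) (z x) (α₀ x) (β₀ x)) = 0)
    (hmα : ∫ x in a..b, m x * deriv α₀ x = 0) :
    ∫ x in a..b, inner ℝ (cylField e (A x) (ρ x) (z x) (α₀ x) (β₀ x))
      (der a b (fun y => ϱ y • der a b (der a b γ) y) x) = 0 := by
  obtain ⟨α, hα, hαd⟩ := C.exists_turning_correctors hab hw hk hm hm0
  have hβ₀m : β₀ ∈ testSpace a b ℝ := by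
    rcases hβ₀ with rfl | rfl
    · exact Submodule.zero_mem _
    · exact hm
  -- The correctors only turn, so the raise stays on the ray through β₀ and the bilinear part of the
  -- holonomy becomes linear in α. For β₀ = m it is the imposed constraint; for β₀ = 0 it is absent.
  have hcomb : ∀ p : ℝ × (Option Bool → ℝ),
      comb β₀ (fun (_ : Option Bool) (_ : ℝ) => (0 : ℝ)) p = fun x => p.1 * β₀ x := fun p => by
    ext x
    simp [comb]
  refine hel.integral_inner_cylField_eq_zero hab hγ hϱ harc C hα₀ hβ₀m (α := α)
    (β := fun _ _ => 0) hα (fun _ => Submodule.zero_mem _)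
    (c := horizontalPair e (A a)) (y := fun _ => 0) (m := turningWeight m) ?_ ?_ hαd ?_
  · rintro (_ | _)
    · exact hm.1
    · exact contDiff_const
  · rintro (_ | t)
    · simpa [cylConstraintLin, turningWeight, horizontalPair] using hmα
    · simpa [cylConstraintLin, turningWeight] using hV _
  · intro p hp
    rw [hcomb] at hp ⊢
    have hsome : ∀ t : Bool, ∫ x in a..b, inner ℝ (horizontalPair e (A a) (some t))
        (cylDisp e (A x) (z x) (comb α₀ α p x) (p.1 * β₀ x)) = 0 := fun t => by
      simpa [cylConstraint, turningWeight] using hp (some t)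
    have hnone : ∫ x in a..b, m x * deriv (comb α₀ α p) x = 0 := by
      simpa [cylConstraint, turningWeight, horizontalPair] using hp none
    have hββ : ∫ x in a..b, p.1 * β₀ x = 0 := by
      rw [intervalIntegral.integral_const_mul, hβ₀i, mul_zero]
    constructor
    · refine integral_eq_zero_of_inner (κ := Option Bool)
        (c := fun i => i.elim e fun t => horizontalPair e (A a) (some t))
        (fun v hv => C.eq_zero_of_inner hab (hv (some true)) (hv (some false)) (hv none))
        hab.le ?_
      rintro (_ | t)
      · rw [← hββ]
        refine intervalIntegral.integral_congr fun x hx => ?_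
        rw [uIcc_of_le hab.le] at hx
        have heA : inner ℝ e (A x) = 0 := by rw [real_inner_comm]; exact C.horizontal x hx
        have hen : ‖e‖ ^ 2 = 1 := by rw [← real_inner_self_eq_norm_sq, C.axis]
        simp [cylDisp, inner_add_right, inner_smul_right, heA, hen]
      · exact hsome t
    · have h1 : ∫ x in a..b, β₀ x * deriv (comb α₀ α p) x = 0 := by
        rcases hβ₀ with h | h
        · simp [h]
        · rw [h]; exact hnone
      have hβs := testSpace.smoothOn hβ₀m
      have hα's := testSpace.smoothOn (testSpace.deriv_mem (comb_mem hα₀ hα p))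
      have h2 : ∫ x in a..b, cylHol a b z k (comb α₀ α p) (fun x => p.1 * β₀ x) x =
          ∫ x in a..b, (w * (p.1 * β₀ x) + p.1 * (β₀ x * deriv (comb α₀ α p) x)) := by
        refine intervalIntegral.integral_congr fun x hx => ?_
        rw [uIcc_of_le hab.le] at hx
        simp only [cylHol, hk x hx, hz x hx]
        ring
      rw [h2, intervalIntegral.integral_add, intervalIntegral.integral_const_mul, hββ,
        intervalIntegral.integral_const_mul, h1]
      · simp
      · exact SmoothOn.intervalIntegrable hab
          (contDiffOn_const.mul (contDiffOn_const.mul hβs))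
      · exact SmoothOn.intervalIntegrable hab (contDiffOn_const.mul (hβs.mul hα's))

/-- The first variation of a curve with uniformly turning tangent. -/
theorem IsHolonomyConstrainedElastic.integral_eq_zero_of_turning (hab : a < b)
    (hγ : IsCurve a b γ) (hϱ : IsStiffness a b ϱ) (harc : IsArcLength a b γ)
    (hel : IsHolonomyConstrainedElastic a b ϱ γ) (C : IsCylindrical a b (der a b γ) e A ρ z k)
    (hw : w ≠ 0) (hk : ∀ x ∈ Icc a b, k x = w) (hz : ∀ x ∈ Icc a b, der a b z x = 0)
    {α β : ℝ → ℝ} (hα : α ∈ testSpace a b ℝ) (hβ : β ∈ testSpace a b ℝ)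
    (hβi : ∫ x in a..b, β x = 0)
    (hV : ∀ c : E3, ∫ x in a..b, inner ℝ c (cylField e (A x) (ρ x) (z x) (α x) (β x)) = 0) :
    ∫ x in a..b, inner ℝ (cylField e (A x) (ρ x) (z x) (α x) (β x))
      (der a b (fun y => ϱ y • der a b (der a b γ) y) x) = 0 := by
  set P' := der a b (fun y => ϱ y • der a b (der a b γ) y) with hP'
  have hP's : SmoothOn a b P' := SmoothOn.smoothOn_der hab (hϱ.smooth.smul
    ((hγ.smooth.smoothOn_der hab).smoothOn_der hab))
  have hfs : ∀ {α β : ℝ → ℝ}, α ∈ testSpace a b ℝ → β ∈ testSpace a b ℝ →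
      SmoothOn a b (fun x => cylField e (A x) (ρ x) (z x) (α x) (β x)) := fun hα hβ =>
    (((testSpace.smoothOn hα).mul C.smooth_ρ).smul C.smooth_n).add
      ((testSpace.smoothOn hβ).smul (contDiffOn_const.sub
        ((C.smooth_z.div C.smooth_ρ fun x hx => (C.pos x hx).ne').smul C.smooth_A)))
  have h0 : (fun _ : ℝ => (0 : ℝ)) ∈ testSpace a b ℝ := Submodule.zero_mem _
  have hpure : ∀ α ∈ testSpace a b ℝ,
      (∀ c : E3, ∫ x in a..b, inner ℝ c (cylField e (A x) (ρ x) (z x) (α x) 0) = 0) →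
      ∫ x in a..b, inner ℝ (cylField e (A x) (ρ x) (z x) (α x) 0) (P' x) = 0 := by
    intro α hα hV
    by_cases hα0 : α = 0
    · simp [hα0]
    -- Without a raise, any nonzero weight m with ∫mα' = 0 is allowed. The choice m = α works
    -- because αα' is the derivative of a test function.
    · exact hel.integral_eq_zero_of_isotropic hab hγ hϱ harc C hw hk hz hα hα0 hα
        (β₀ := 0) (Or.inl rfl) (by simp) hV (testSpace.integral_mul_deriv_self hab hα)
  by_cases hβ0 : β = 0
  · subst hβ0
    exact hpure α hα hV
  -- The turn `η none` satisfies closure to first order and has ∫βη' = 1. Subtracting s times it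
  -- from α makes the direction isotropic, and the part removed is a pure turn covered by `hpure`.
  obtain ⟨η, hη, hηd⟩ := C.exists_turning_correctors hab hw hk hβ hβ0
  set s := ∫ x in a..b, β x * deriv α x with hs
  have hηβ : ∫ x in a..b, β x * deriv (η none) x = 1 := by
    simpa [cylConstraintLin, turningWeight, horizontalPair] using hηd none none
  have hηV : ∀ c : E3,
      ∫ x in a..b, inner ℝ c (cylField e (A x) (ρ x) (z x) (η none x) 0) = 0 := by
    have hzero : ∫ x in a..b, cylField e (A x) (ρ x) (z x) (η none x) 0 = 0 := by
      refine integral_eq_zero_of_inner (κ := Option Bool)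
        (c := fun i => i.elim e fun t => horizontalPair e (A a) (some t))
        (fun v hv => C.eq_zero_of_inner hab (hv (some true)) (hv (some false)) (hv none))
        hab.le ?_
      rintro (_ | t)
      · simp [cylField, inner_smul_right]
      · simpa [cylConstraintLin, turningWeight] using hηd (some t) none
    intro c
    rw [intervalIntegral.integral_of_le hab.le] at hzero ⊢
    rw [integral_inner ((intervalIntegrable_iff_integrableOn_Ioc_of_le hab.le).1
      ((hfs (hη none) h0).intervalIntegrable hab)) c, hzero, inner_zero_right]
  set α₁ : ℝ → ℝ := α - s • η none with hα₁
  have hα₁m : α₁ ∈ testSpace a b ℝ := Submodule.sub_mem _ hα (Submodule.smul_mem _ _ (hη none))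
  have hsplit : ∀ x, cylField e (A x) (ρ x) (z x) (α₁ x) (β x) =
      cylField e (A x) (ρ x) (z x) (α x) (β x) -
        s • cylField e (A x) (ρ x) (z x) (η none x) 0 := fun x => by
    simp only [cylField, hα₁, Pi.sub_apply, Pi.smul_apply, smul_eq_mul]
    module
  have hα₁d : ∀ x, deriv α₁ x = deriv α x - s * deriv (η none) x := fun x =>
    ((testSpace.hasDerivAt hα x).sub ((testSpace.hasDerivAt (hη none) x).const_mul s)).deriv
  have hβs := testSpace.smoothOn hβ
  have key := hel.integral_eq_zero_of_isotropic hab hγ hϱ harc C hw hk hz hβ hβ0 hα₁m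
    (β₀ := β) (Or.inr rfl) hβi
    (fun c => by
      simp only [hsplit, inner_sub_right, inner_smul_right]
      rw [intervalIntegral.integral_sub, intervalIntegral.integral_const_mul, hV, hηV]
      · simp
      · exact SmoothOn.intervalIntegrable hab (ContDiffOn.inner ℝ contDiffOn_const (hfs hα hβ))
      · exact (SmoothOn.intervalIntegrable hab
          (ContDiffOn.inner ℝ contDiffOn_const (hfs (hη none) h0))).const_mul s)
    (by
      have : ∀ x, β x * deriv α₁ x = β x * deriv α x - s * (β x * deriv (η none) x) :=
        fun x => by rw [hα₁d]; ring
      simp only [this]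
      rw [intervalIntegral.integral_sub, intervalIntegral.integral_const_mul, hηβ, ← hs]
      · ring
      · exact SmoothOn.intervalIntegrable hab
          (hβs.mul (testSpace.smoothOn (testSpace.deriv_mem hα)))
      · exact (SmoothOn.intervalIntegrable hab
          (hβs.mul (testSpace.smoothOn (testSpace.deriv_mem (hη none))))).const_mul s)
  simp only [hsplit, inner_sub_left, inner_smul_left, conj_trivial] at key
  rw [intervalIntegral.integral_sub, intervalIntegral.integral_const_mul,
    hpure _ (hη none) hηV, mul_zero, sub_zero] at key
  · exact key
  · exact SmoothOn.intervalIntegrable hab (ContDiffOn.inner ℝ (hfs hα hβ) hP's)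
  · exact (SmoothOn.intervalIntegrable hab
      (ContDiffOn.inner ℝ (hfs (hη none) h0) hP's)).const_mul s

end Helix

/-! ### Case distinction and the integrated Euler-Lagrange equation. -/

section Conclusion

open MeasureTheory Topology

variable {a b : ℝ} {γ : ℝ → E3} {ϱ : ℝ → ℝ}

theorem eqOn_Icc_of_eqOn_Ioo {F : Type*} [NormedAddCommGroup F] (hab : a < b) {f g : ℝ → F}
    (hf : ContinuousOn f (Icc a b)) (hg : ContinuousOn g (Icc a b))
    (h : ∀ x ∈ Ioo a b, f x = g x) : ∀ x ∈ Icc a b, f x = g x :=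
  EqOn.of_subset_closure h hf hg Ioo_subset_Icc_self (closure_Ioo hab.ne).ge

theorem sum_constraintDensity (c : Option (Fin 3) → ℝ) (T T' : E3) :
    ∑ i, c i • constraintDensity T T' i =
      cross T (∑ i, c (some i) • EuclideanSpace.single i (1 : ℝ)) - c none • T' := by
  simp only [Fintype.sum_option, constraintDensity, Fin.sum_univ_three, cross_add_right,
    cross_smul_right]
  module

/-- The unit tangent of a curve with dependent linearized constraints is constant or turns uniformly
about an axis. -/
theorem exists_angular_velocity (hab : a < b) {T : ℝ → E3} (hT : SmoothOn a b T)
    (hT1 : ∀ x ∈ Icc a b, inner ℝ (T x) (T x) = 1) (hns : ∃ x ∈ Icc a b, der a b T x ≠ 0)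
    {c : Option (Fin 3) → ℝ} (hc0 : c ≠ 0)
    (hc : ∀ x ∈ Ioo a b, ∑ i, c i • constraintDensity (T x) (der a b T x) i = 0) :
    ∃ (e : E3) (w : ℝ), inner ℝ e e = 1 ∧ w ≠ 0 ∧
      ∀ x ∈ Icc a b, der a b T x = w • cross e (T x) := by
  set l : E3 := ∑ i, c (some i) • EuclideanSpace.single i (1 : ℝ) with hl
  have hT's := hT.smoothOn_der hab
  have hrel : ∀ x ∈ Icc a b, cross (T x) l = c none • der a b T x := by
    refine eqOn_Icc_of_eqOn_Ioo hab
      (ContDiffOn.continuousOn (n := ∞) (hT.cross contDiffOn_const))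
      (hT's.continuousOn.const_smul (c none)) fun x hx => ?_
    have := hc x hx
    rw [sum_constraintDensity] at this
    exact sub_eq_zero.1 this
  obtain ⟨x₀, hx₀, hne⟩ := hns
  -- If c none = 0, then T × l = 0 identically and, differentiating, T' × l = 0. At a point where T'
  -- ≠ 0 the vector l is parallel to T and to the nonzero T' ⊥ T, so l = 0 and the relation is
  -- trivial.
  have hcn : c none ≠ 0 := fun h0 => by
    simp only [h0, zero_smul] at hrel
    have h1 : cross (der a b T x₀) l = 0 := by
      have h := (hT.hasDerivWithinAt hx₀).cross (hasDerivWithinAt_const x₀ (Icc a b) l)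
      have h' := (hasDerivWithinAt_const x₀ (Icc a b) (0 : E3)).congr hrel (hrel x₀ hx₀)
      have := (h.der_eq hab hx₀).symm.trans (h'.der_eq hab hx₀)
      simpa using this
    have h2 : l = inner ℝ (T x₀) l • T x₀ := by
      have := cross_cross_left (T x₀) (T x₀) l
      rw [hrel x₀ hx₀, cross_zero_right, hT1 x₀ hx₀, one_smul] at this
      exact (sub_eq_zero.1 this.symm).symm
    have h3 : inner ℝ (T x₀) l = 0 := by
      by_contra h
      rw [h2, cross_smul_right] at h1
      have h4 := (smul_eq_zero.1 h1).resolve_left h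
      have := cross_cross_left (T x₀) (der a b T x₀) (T x₀)
      rw [h4, cross_zero_right, hT1 x₀ hx₀, inner_der_self_eq_zero hab hT hT1 hx₀, one_smul,
        zero_smul, sub_zero] at this
      exact hne this.symm
    rw [h3, zero_smul] at h2
    refine hc0 (funext fun i => ?_)
    rcases i with _ | i
    · exact h0
    · have := congrArg (fun v : E3 => v i) (hl.symm.trans h2)
      fin_cases i <;> simpa [Fin.sum_univ_three] using this
  have hl0 : l ≠ 0 := fun h => by
    have := hrel x₀ hx₀
    rw [h, cross_zero_right] at this
    exact hne ((smul_eq_zero.1 this.symm).resolve_left hcn)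
  have hln : ‖l‖ ≠ 0 := norm_ne_zero_iff.2 hl0
  refine ⟨‖l‖⁻¹ • l, -(c none)⁻¹ * ‖l‖, ?_, mul_ne_zero (neg_ne_zero.2 (inv_ne_zero hcn)) hln,
    fun x hx => ?_⟩
  · rw [real_inner_self_eq_norm_sq, norm_smul, norm_inv, norm_norm, inv_mul_cancel₀ hln, one_pow]
  · rw [cross_smul_left, cross_swap, hrel x hx, smul_neg, smul_smul, smul_neg, smul_smul]
    rw [show -(c none)⁻¹ * ‖l‖ * (‖l‖⁻¹ * c none) = -1 by field_simp]
    module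

/-- Independent densities allow any axis avoided by the tangent. Dependent ones make T turn
uniformly about a definite axis e; this axis is itself avoided, since ⟨T, e⟩ is constant and |T'|² =
w²(1 - ⟨T, e⟩²) is nonzero somewhere. -/
theorem IsHolonomyConstrainedElastic.integral_inner_cross_eq_zero (hab : a < b)
    (hγ : IsCurve a b γ) (hϱ : IsStiffness a b ϱ) (harc : IsArcLength a b γ)
    (hel : IsHolonomyConstrainedElastic a b ϱ γ)
    (hns : ∃ x ∈ Icc a b, der a b (der a b γ) x ≠ 0) {U : ℝ → E3} (hU : U ∈ testSpace a b E3)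
    (hU0 : ∀ i, ∫ x in a..b, inner ℝ (U x)
      (constraintDensity (der a b γ x) (der a b (der a b γ) x) i) = 0) :
    ∫ x in a..b, inner ℝ (cross (U x) (der a b γ x))
      (der a b (fun y => ϱ y • der a b (der a b γ) y) x) = 0 := by
  have hTs : SmoothOn a b (der a b γ) := hγ.smooth.smoothOn_der hab
  have hT1 : ∀ x ∈ Icc a b, inner ℝ (der a b γ x) (der a b γ x) = 1 := fun x hx => by
    rw [real_inner_self_eq_norm_sq, harc x hx, one_pow]
  by_cases hind : ∀ c : Option (Fin 3) → ℝ, (∀ x ∈ Ioo a b,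
      ∑ i, c i • constraintDensity (der a b γ x) (der a b (der a b γ) x) i = 0) → c = 0
  · obtain ⟨e, he, hlt⟩ := exists_axis hab hTs harc
    obtain ⟨A, ρ, k, C⟩ := exists_isCylindrical hab hTs harc he hlt
    exact hel.integral_eq_zero_of_independent hab hγ hϱ harc C hind hU hU0
  push Not at hind
  obtain ⟨c, hc, hc0⟩ := hind
  obtain ⟨e, w, he, hw, hT'⟩ := exists_angular_velocity hab hTs hT1 hns hc0 hc
  set z : ℝ → ℝ := fun x => inner ℝ (der a b γ x) e with hz
  have hz' : ∀ x ∈ Icc a b, HasDerivWithinAt z 0 (Icc a b) x := fun x hx => by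
    refine ((hTs.hasDerivWithinAt hx).inner ℝ
      (hasDerivWithinAt_const x (Icc a b) e)).congr_deriv ?_
    rw [hT' x hx, inner_zero_right, inner_smul_left, real_inner_comm, inner_cross_self_left]
    simp
  have hzc : ∀ x ∈ Icc a b, z x = z a := constant_of_derivWithin_zero
    (fun x hx => (hz' x hx).differentiableWithinAt)
    fun x hx => (hz' x (Ico_subset_Icc_self hx)).der_eq hab (Ico_subset_Icc_self hx)
  have hsq : ∀ x ∈ Icc a b, ‖der a b (der a b γ) x‖ ^ 2 = w ^ 2 * (1 - z x ^ 2) := fun x hx => by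
    rw [← real_inner_self_eq_norm_sq, hT' x hx, inner_smul_left, inner_smul_right,
      inner_cross_cross, he, hT1 x hx, real_inner_comm e]
    simp only [conj_trivial, hz]
    rw [real_inner_comm e]
    ring
  obtain ⟨x₀, hx₀, hne⟩ := hns
  have hlt : ∀ x ∈ Icc a b, inner ℝ (der a b γ x) e ^ 2 < 1 := fun x hx => by
    have h1 : 0 < w ^ 2 * (1 - z x₀ ^ 2) := by
      rw [← hsq x₀ hx₀]
      exact pow_pos (norm_pos_iff.2 hne) 2
    have h2 : 0 < 1 - z x₀ ^ 2 := pos_of_mul_pos_right h1 (sq_nonneg w)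
    have h3 : z x = z x₀ := (hzc x hx).trans (hzc x₀ hx₀).symm
    have h4 : z x ^ 2 < 1 := by rw [h3]; linarith
    exact h4
  obtain ⟨A, ρ, k, C⟩ := exists_isCylindrical hab hTs harc he hlt
  have hk : ∀ x ∈ Icc a b, k x = w := fun x hx => by
    have h1 := congrArg (fun v => inner ℝ v (cross e (A x))) (C.deriv_T hab hx)
    have heA : inner ℝ e (A x) = 0 := by rw [real_inner_comm]; exact C.horizontal x hx
    rw [hT' x hx, C.eq x hx] at h1
    simp only [inner_add_left, inner_smul_left, cross_add_right, cross_smul_right,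
      cross_self_eq_zero, inner_cross_self_right, inner_cross_self_left, conj_trivial,
      inner_cross_cross, C.axis, C.unit x hx, heA, C.horizontal x hx, inner_zero_left] at h1
    have hρ := (C.pos x hx).ne'
    have : ρ x * (k x - w) = 0 := by linarith
    linarith [(mul_eq_zero.1 this).resolve_left hρ]
  obtain ⟨α, hα, β, hβ, hfield, hβe⟩ := C.exists_cylField_eq hTs hU
  have hcr := _root_.integral_inner_cross_eq_zero hab hTs hU fun i => hU0 (some i)
  have key := hel.integral_eq_zero_of_turning hab hγ hϱ harc C hw hk
    (fun x hx => (hz' x hx).der_eq hab hx) hα hβ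
    (by
      rw [← hcr e]
      refine intervalIntegral.integral_congr fun x _ => ?_
      rw [hβe, real_inner_comm])
    (fun c => by
      rw [← hcr c]
      refine intervalIntegral.integral_congr fun x hx => ?_
      rw [uIcc_of_le hab.le] at hx
      rw [hfield x hx])
  rw [← key]
  refine intervalIntegral.integral_congr fun x hx => ?_
  rw [uIcc_of_le hab.le] at hx
  rw [hfield x hx]

/-- The once integrated Euler-Lagrange equation. -/
theorem IsHolonomyConstrainedElastic.exists_euler_lagrange (hab : a < b)
    (hγ : IsCurve a b γ) (hϱ : IsStiffness a b ϱ) (harc : IsArcLength a b γ)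
    (hel : IsHolonomyConstrainedElastic a b ϱ γ) :
    ∃ (μ : ℝ) (A B : E3), ∀ x ∈ Icc a b,
      ϱ x • cross (der a b γ x) (der a b (der a b γ) x) =
        -μ • der a b γ x + cross (γ x) A + B := by
  by_cases hns : ∃ x ∈ Icc a b, der a b (der a b γ) x ≠ 0
  swap
  -- On a straight segment the left side vanishes, so zero constants suffice.
  · push Not at hns
    exact ⟨0, 0, 0, fun x hx => by simp [hns x hx]⟩
  have hTs : SmoothOn a b (der a b γ) := hγ.smooth.smoothOn_der hab
  have hT's := hTs.smoothOn_der hab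
  set P : ℝ → E3 := fun y => ϱ y • der a b (der a b γ) y with hP
  have hPs : SmoothOn a b P := hϱ.smooth.smul hT's
  have hcont : ∀ i, ContinuousOn
      (fun x => constraintDensity (der a b γ x) (der a b (der a b γ) x) i) (Icc a b)
    | some i => ContDiffOn.continuousOn (n := ∞) (hTs.cross contDiffOn_const)
    | none => hT's.continuousOn.neg
  obtain ⟨c, hc⟩ := exists_multipliers hab.le hcont
    (g := fun x => cross (der a b γ x) (der a b P x))
    (ContDiffOn.continuousOn (n := ∞) (hTs.cross (hPs.smoothOn_der hab))) fun U hU hU0 => by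
      rw [← hel.integral_inner_cross_eq_zero hab hγ hϱ harc hns hU hU0]
      exact intervalIntegral.integral_congr fun x _ => inner_cross_cyclic _ _ _
  set l : E3 := ∑ i, c (some i) • EuclideanSpace.single i (1 : ℝ) with hl
  -- A primitive of the multiplier relation: the extra term T' × P produced by differentiating T × P
  -- is zero, since P is a multiple of T'.
  set Φ : ℝ → E3 := fun x =>
    cross (der a b γ x) (P x) - cross (γ x) l + c none • der a b γ x with hΦ
  have hΦs : SmoothOn a b Φ := ((hTs.cross hPs).sub (hγ.smooth.cross contDiffOn_const)).add
    (ContDiffOn.const_smul (c none) hTs)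
  have hΦ' : ∀ x ∈ Icc a b, der a b Φ x = 0 := by
    refine eqOn_Icc_of_eqOn_Ioo hab (hΦs.smoothOn_der hab).continuousOn continuousOn_const
      fun x hx => ?_
    have hx' := Ioo_subset_Icc_self hx
    have h := (((hTs.hasDerivWithinAt hx').cross (hPs.hasDerivWithinAt hx')).sub
      ((hγ.smooth.hasDerivWithinAt hx').cross (hasDerivWithinAt_const x (Icc a b) l))).add
      ((hTs.hasDerivWithinAt hx').const_smul (c none))
    refine (h.der_eq hab hx').trans ?_
    rw [hc x hx, sum_constraintDensity, ← hl]
    simp only [hP, cross_smul_right, cross_self_eq_zero, cross_zero_right, smul_zero]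
    module
  have hΦc : ∀ x ∈ Icc a b, Φ x = Φ a := constant_of_derivWithin_zero
    (hΦs.differentiableOn (by simp)) fun x hx => hΦ' x (Ico_subset_Icc_self hx)
  refine ⟨c none, l, Φ a, fun x hx => ?_⟩
  rw [← hΦc x hx]
  simp only [hΦ, hP, cross_smul_right]
  module

end Conclusion

theorem corollary4p2 (a b : ℝ) (hab : a < b) (γ : ℝ → E3) (ϱ : ℝ → ℝ)
    (hγ : IsCurve a b γ) (hϱ : IsStiffness a b ϱ) (harc : IsArcLength a b γ)
    (hel : IsHolonomyConstrainedElastic a b ϱ γ) :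
    ∃ (μ : ℝ) (A B : E3),
      (∀ x ∈ Icc a b,
        ϱ x • cross (der a b γ x) (der a b (der a b γ) x) =
          -μ • der a b γ x + cross (γ x) A + B) ∧
      ∀ x ∈ Icc a b,
        0 ≤ ϱ x * inner ℝ (cross (der a b γ x) (der a b (der a b γ) x))
          (-μ • der a b γ x + cross (γ x) A + B) ∧
        (0 < ϱ x * inner ℝ (cross (der a b γ x) (der a b (der a b γ) x))
            (-μ • der a b γ x + cross (γ x) A + B) ↔
          der a b (der a b γ) x ≠ 0) := by
  obtain ⟨μ, A, B, h⟩ := hel.exists_euler_lagrange hab hγ hϱ harc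
  refine ⟨μ, A, B, h, fun x hx => ?_⟩
  have hT1 : ∀ x ∈ Icc a b, inner ℝ (der a b γ x) (der a b γ x) = 1 := fun x hx => by
    rw [real_inner_self_eq_norm_sq, harc x hx, one_pow]
  have hperp := inner_der_self_eq_zero hab (hγ.smooth.smoothOn_der hab) hT1 hx
  -- By the equation just obtained the right-hand vector is ϱ T × T', and |T × T'| = |T'| since T is
  -- a unit vector orthogonal to T'.
  have hval : ϱ x * inner ℝ (cross (der a b γ x) (der a b (der a b γ) x))
      (ϱ x • cross (der a b γ x) (der a b (der a b γ) x)) =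
      ϱ x ^ 2 * ‖der a b (der a b γ) x‖ ^ 2 := by
    rw [inner_smul_right, inner_cross_cross, hT1 x hx, hperp, real_inner_self_eq_norm_sq]
    ring
  have hϱ2 : 0 < ϱ x ^ 2 := pow_pos (hϱ.pos x hx) 2
  rw [← h x hx, hval]
  refine ⟨by positivity, fun hpos h0 => ?_, fun hne => ?_⟩
  · simp [h0] at hpos
  · exact mul_pos hϱ2 (pow_pos (norm_pos_iff.2 hne) 2)
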